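/- Let $B$ be a smooth $n$-dimensional manifold without boundary (Hausdorff, second countable), $J^1B=T^*B\times\mathbb R$ its one-jet bundle with contact form $\lambda=dz-p\,dq$, Reeb field $R_\lambda=\partial_z$, projection $\pi_B:J^1B\to B$ and zero section $o_{J^1B}=\{p=0,\ z=0\}$. Let $H=H(t,y)$ be a smooth function on $[0,1]\times J^1B$, let $X_{H_t}$ be its contact Hamiltonian vector field, given by $\lambda(X_{H_t})=-H_t$ and $dH_t=X_{H_t}\rfloor d\lambda+R_\lambda[H_t]\,\lambda$, and suppose that its flow $\psi_H^t$ is defined for $t\in[0,1]$ as a smooth isotopy of diffeomorphisms of $J^1B$ with $\psi_H^0=\mathrm{id}$ (as is the case when $H$ has compact support). Put $\phi_H^t=\psi_H^t(\psi_H^1)^{-1}$, and let $g_f$ denote the conformal exponent of a contactomorphism $f$, i.e. $f^*\lambda=e^{g_f}\lambda$. Let $\mathcal L_0$ be the space of smooth paths $\gamma:[0,1]\to J^1B$ with $\lambda(\dot\gamma(t))+H(t,\gamma(t))=0$ for all $t$ and $\gamma(0)\in o_{J^1B}$, fibred over $B$ by $\Pi(\gamma)=\pi_B(\gamma(1))$,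 and let $$\mathcal A_H^{CC}(\gamma)=-\int_0^1 e^{g_{(\phi_H^t)^{-1}}(\gamma(t))}\bigl(\lambda(\dot\gamma(t))+H(t,\gamma(t))\bigr)\,dt+z(\gamma(1)),\qquad \gamma\in\mathcal L_0 .$$ A tangent vector $\eta$ of $\mathcal L_0$ at $\gamma$ is the velocity at $s=0$ of a smooth family $s\mapsto\gamma_s$ in $\mathcal L_0$ with $\gamma_0=\gamma$. Let $\Sigma\subset\mathcal L_0$ be the vertical critical set, i.e. the set of $\gamma$ such that $d\mathcal A_H^{CC}(\gamma)(\eta)=0$ for all tangent vectors $\eta$ at $\gamma$ with $d\Pi(\eta)=0$. Then for every $\gamma\in\Sigma$ there is exactly one covector $D^h\mathcal A_H^{CC}(\gamma)\in T^*_{\Pi(\gamma)}B$ with $d\mathcal A_H^{CC}(\gamma)(\eta)=D^h\mathcal A_H^{CC}(\gamma)(d\Pi(\eta))$ for all tangent vectors $\eta$ at $\gamma$, so that the map $$i=j^1\mathcal A_H^{CC}:\Sigma\to J^1B,\qquad i(\gamma)=\bigl(\Pi(\gamma),\,D^h\mathcal A_H^{CC}(\gamma),\,\mathcal A_H^{CC}(\gamma)\bigr)$$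 is well defined. Moreover $i(\gamma)=\gamma(1)$ for all $\gamma\in\Sigma$; the map $i$ is injective, and it is continuous for the topology of uniform convergence on $\Sigma$ (hence for every finer one, such as the $C^\infty$ topology); and its image is $\psi_H^1(o_{J^1B})$. That is, $i$ is a continuous bijection of $\Sigma$ onto $\psi_H^1(o_{J^1B})$. -/

import Mathlib

open Set Manifold ContDiff Bundle

noncomputable section

namespace OneJet

/-! ### The one-jet bundle and its contact form -/

/-- The model space of a manifold of dimension `n`. -/
abbrev Model (n : ℕ) : Type := EuclideanSpace ℝ (Fin n)

section Spaces

variable (n : ℕ) (B : Type*) [TopologicalSpace B] [ChartedSpace (Model n) B]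
  [IsManifold (𝓡 n) ∞ B]

/-- The fibre `T_b^*B` of the cotangent bundle. -/
abbrev CotangentFibre (b : B) : Type := TangentSpace (𝓡 n) b →L[ℝ] Bundle.Trivial B ℝ b

/-- The cotangent bundle `T^*B`, with Mathlib's smooth structure on the bundle of continuous linear
maps from the tangent bundle to the trivial line bundle. -/
abbrev Cotangent : Type _ := TotalSpace (Model n →L[ℝ] ℝ) (CotangentFibre n B)

/-- The one-jet bundle `J^1B = T^*B × ℝ`; a point is `y = ((q, p), z)`. -/
abbrev J1 : Type _ := Cotangent n B × ℝ

/-- The vector space on which the manifold `J^1B` is modelled. -/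
abbrev J1Space : Type := (Model n × (Model n →L[ℝ] ℝ)) × ℝ

/-- The model with corners (without boundary) of `J^1B`. -/
abbrev J1Model : ModelWithCorners ℝ (J1Space n)
    (ModelProd (ModelProd (Model n) (Model n →L[ℝ] ℝ)) ℝ) :=
  ((𝓡 n).prod 𝓘(ℝ, Model n →L[ℝ] ℝ)).prod 𝓘(ℝ, ℝ)

/-- The zero section `o_{J^1B} = {p = 0, z = 0}`. -/
def zeroSection : Set (J1 n B) := {y | y.1.2 = 0 ∧ y.2 = 0}

end Spaces

variable {n : ℕ} {B : Type*} [TopologicalSpace B] [ChartedSpace (Model n) B]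
  [IsManifold (𝓡 n) ∞ B]

/-- The projection `π_B : J^1B → B`. -/
def toBase (y : J1 n B) : B := y.1.proj

/-- The coordinate function `z : J^1B → ℝ`. -/
def zCoord (y : J1 n B) : ℝ := y.2

/-- The fibre coordinate `p ∈ T_q^*B` of `y = ((q, p), z)`. -/
def momentum (y : J1 n B) : TangentSpace (𝓡 n) (toBase y) →L[ℝ] ℝ := y.1.2

/-- The standard contact form `λ = dz - p dq`: at `y = ((q, p), z)` its value on `v` is
`dz(v) - p(dπ_B(v))`. -/
def contactForm (y : J1 n B) : TangentSpace (J1Model n) y →L[ℝ] ℝ :=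
  mvfderiv (J1Model n) zCoord y - (momentum y).comp (mfderiv (J1Model n) (𝓡 n) toBase y)

/-- The contact form written in the chart of `J^1B` around `y₀`: a map from the model space to its
dual. -/
def contactFormInChart (y₀ : J1 n B) (x : J1Space n) : J1Space n →L[ℝ] ℝ :=
  (contactForm ((extChartAt (J1Model n) y₀).symm x)).comp
    ((mfderiv 𝓘(ℝ, J1Space n) (J1Model n) (extChartAt (J1Model n) y₀).symm x).comp
      (NormedSpace.fromTangentSpace (𝕜 := ℝ) x).symm.toContinuousLinearMap)

/-- The exterior derivative `dλ` at `y`, computed in the chart around `y`: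
`dλ(u, v) = D_u λ(v) - D_v λ(u)`. -/
def dContactForm (y : J1 n B) (u v : TangentSpace (J1Model n) y) : ℝ :=
  let χ := extChartAt (J1Model n) y
  let u' : J1Space n := mvfderiv (J1Model n) χ y u
  let v' : J1Space n := mvfderiv (J1Model n) χ y v
  fderiv ℝ (contactFormInChart y) (χ y) u' v' - fderiv ℝ (contactFormInChart y) (χ y) v' u'

/-- The unit tangent vector of the real line at `t`. -/
def unitTangent (t : ℝ) : TangentSpace 𝓘(ℝ, ℝ) t := (NormedSpace.fromTangentSpace t).symm (1 : ℝ)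

/-- The Reeb vector field `∂/∂z` of `λ`. -/
def reeb (y : J1 n B) : TangentSpace (J1Model n) y :=
  mfderiv 𝓘(ℝ, ℝ) (J1Model n) (fun s : ℝ => ((y.1, s) : J1 n B)) y.2 (unitTangent y.2)

/-! ### Contact Hamiltonian dynamics -/

/-- `X` is the value at `y` of the contact Hamiltonian vector field of the function `h`:
`λ(X) = -h` and `dh = X ⌟ dλ + R_λ[h] λ`. -/
def IsContactHamiltonianVector (h : J1 n B → ℝ) (y : J1 n B) (X : TangentSpace (J1Model n) y) :
    Prop :=
  contactForm y X = -h y ∧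
    ∀ v : TangentSpace (J1Model n) y,
      mvfderiv (J1Model n) h y v =
        dContactForm y X v + mvfderiv (J1Model n) h y (reeb y) * contactForm y v

/-- `H = H(t, y)` is a smooth time-dependent function on `[0,1] × J^1B` (values at other times are
irrelevant everywhere below). -/
def IsSmoothHamiltonian (H : ℝ → J1 n B → ℝ) : Prop :=
  ContMDiffOn (𝓘(ℝ, ℝ).prod (J1Model n)) 𝓘(ℝ, ℝ) ∞ (fun x : ℝ × J1 n B => H x.1 x.2)
    (Icc 0 1 ×ˢ univ)

/-- `ψ^t`, `t ∈ [0,1]`, is the contact Hamiltonian flow `ψ_H^t` of `H`: the smooth isotopy of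
diffeomorphisms of `J^1B` with `ψ^0 = id` and `∂_t ψ^t(y) = X_{H_t}(ψ^t(y))`. -/
structure IsContactHamiltonianFlow (H : ℝ → J1 n B → ℝ) (ψ : ℝ → J1 n B ≃ J1 n B) : Prop where
  smooth : ContMDiffOn (𝓘(ℝ, ℝ).prod (J1Model n)) (J1Model n) ∞
    (fun x : ℝ × J1 n B => ψ x.1 x.2) (Icc 0 1 ×ˢ univ)
  smooth_symm : ContMDiffOn (𝓘(ℝ, ℝ).prod (J1Model n)) (J1Model n) ∞
    (fun x : ℝ × J1 n B => (ψ x.1).symm x.2) (Icc 0 1 ×ˢ univ)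
  zero : ∀ y, ψ 0 y = y
  deriv : ∀ t ∈ Icc (0 : ℝ) 1, ∀ y, IsContactHamiltonianVector (H t) (ψ t y)
    (mfderivWithin 𝓘(ℝ, ℝ) (J1Model n) (fun s : ℝ => ψ s y) (Icc 0 1) t (unitTangent t))

/-- The isotopy `φ_H^t = ψ_H^t ∘ (ψ_H^1)⁻¹`. -/
def phi (ψ : ℝ → J1 n B ≃ J1 n B) (t : ℝ) : J1 n B ≃ J1 n B := (ψ 1).symm.trans (ψ t)

/-- The conformal exponent `g_f` of a contactomorphism `f`, determined by `f^*λ = e^{g_f} λ`. -/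
def conformalExponent (f : J1 n B → J1 n B) (y : J1 n B) : ℝ :=
  Classical.epsilon fun g : ℝ => ∀ v : TangentSpace (J1Model n) y,
    contactForm (f y) (mfderiv (J1Model n) (J1Model n) f y v) = Real.exp g * contactForm y v

/-! ### Path spaces and the action functional -/

/-- A path `γ : [0,1] → J^1B` as a function of a real variable, constant outside `[0,1]`; it is only
evaluated and differentiated within `[0,1]`. -/
def ext (γ : C(unitInterval, J1 n B)) : ℝ → J1 n B := IccExtend zero_le_one γ

/-- `γ` is smooth on `[0,1]`, up to and including the end points. -/
def IsSmoothPath (γ : C(unitInterval, J1 n B)) : Prop :=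
  ContMDiffOn 𝓘(ℝ, ℝ) (J1Model n) ∞ (ext γ) (Icc 0 1)

/-- The velocity `γ'(t)`, for `t ∈ [0,1]` (one-sided at the end points). -/
def velocity (γ : C(unitInterval, J1 n B)) (t : ℝ) : TangentSpace (J1Model n) (ext γ t) :=
  mfderivWithin 𝓘(ℝ, ℝ) (J1Model n) (ext γ) (Icc 0 1) t (unitTangent t)

/-- The function `t ↦ λ(γ'(t)) + H(t, γ(t))`. -/
def contactDefect (H : ℝ → J1 n B → ℝ) (γ : C(unitInterval, J1 n B)) (t : ℝ) : ℝ :=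
  contactForm (ext γ t) (velocity γ t) + H t (ext γ t)

/-- The perturbed action functional
`A_H(γ) = ∫₀¹ e^{g_{(φ_H^t)⁻¹}(γ(t))} (λ(γ'(t)) + H_t(γ(t))) dt`. -/
def perturbedAction (H : ℝ → J1 n B → ℝ) (ψ : ℝ → J1 n B ≃ J1 n B)
    (γ : C(unitInterval, J1 n B)) : ℝ :=
  ∫ t in (0 : ℝ)..1,
    Real.exp (conformalExponent (phi ψ t).symm (ext γ t)) * contactDefect H γ t

/-- The effective action functional `Ã_H(γ) = -A_H(γ) + z(γ(1))`. -/
def effectiveAction (H : ℝ → J1 n B → ℝ) (ψ : ℝ → J1 n B ≃ J1 n B)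
    (γ : C(unitInterval, J1 n B)) : ℝ :=
  -perturbedAction H ψ γ + zCoord (γ 1)

/-- The space `L_0^{Carnot}(J^1B, H; o_{J^1B})` of smooth paths with `λ(γ') + H(t, γ) = 0` on `[0,1]`
that start on the zero section. It carries the topology of uniform convergence (the compact-open
topology). -/
abbrev CarnotPath (H : ℝ → J1 n B → ℝ) : Type _ :=
  {γ : C(unitInterval, J1 n B) // IsSmoothPath γ ∧
    (∀ t ∈ Icc (0 : ℝ) 1, contactDefect H γ t = 0) ∧ γ 0 ∈ zeroSection n B}

variable {H : ℝ → J1 n B → ℝ}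

/-- The evaluation `γ ↦ γ(1)`. -/
def evalOne (γ : CarnotPath H) : J1 n B := γ.1 1

/-- The fibration `Π : γ ↦ π_B(γ(1))`. -/
def fibration (γ : CarnotPath H) : B := toBase (evalOne γ)

/-- The functional `A_H^{CC}`, the restriction of the effective action functional. -/
def actionCC (ψ : ℝ → J1 n B ≃ J1 n B) (γ : CarnotPath H) : ℝ := effectiveAction H ψ γ.1

/-! ### Vertical critical points and the one-jet of the functional

A tangent vector of the path space at `γ` is the velocity at `s = 0` of a smooth curve `s ↦ c s` of
paths in the space with `c 0 = γ`. -/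

/-- `s ↦ c s` is smooth near `s = 0` as a curve of paths: `(s, t) ↦ c s t` is smooth on
`(-δ, δ) × [0,1]` for some `δ > 0`. -/
def IsSmoothFamily (c : ℝ → CarnotPath H) : Prop :=
  ∃ δ > (0 : ℝ), ContMDiffOn (𝓘(ℝ, ℝ).prod 𝓘(ℝ, ℝ)) (J1Model n) ∞
    (fun x : ℝ × ℝ => ext (c x.1).1 x.2) (Ioo (-δ) δ ×ˢ Icc 0 1)

/-- `c` represents a tangent vector `η` of the path space at `γ` with `dΠ(η) = v`. -/
def RepresentsOver (c : ℝ → CarnotPath H) (γ : CarnotPath H)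
    (v : TangentSpace (𝓡 n) (fibration γ)) : Prop :=
  IsSmoothFamily c ∧ c 0 = γ ∧
    tangentMap 𝓘(ℝ, ℝ) (𝓡 n) (fun s : ℝ => fibration (c s)) ⟨0, unitTangent 0⟩ =
      (⟨fibration γ, v⟩ : TangentBundle (𝓡 n) B)

/-- The vertical critical set `Σ`: the paths at which the differential of `A_H^{CC}` vanishes on
`ker dΠ`. -/
def verticalCriticalSet (H : ℝ → J1 n B → ℝ) (ψ : ℝ → J1 n B ≃ J1 n B) : Set (CarnotPath H) :=
  {γ | ∀ c : ℝ → CarnotPath H, RepresentsOver c γ 0 →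
    HasDerivAt (fun s : ℝ => actionCC ψ (c s)) 0 0}

/-- `α ∈ T^*_{Π(γ)}B` is the horizontal derivative of `A_H^{CC}` at `γ`:
`dA_H^{CC}(γ)(η) = α(dΠ(η))` for all tangent vectors `η`. -/
def IsHorizontalDerivative (ψ : ℝ → J1 n B ≃ J1 n B) (γ : CarnotPath H)
    (α : CotangentFibre n B (fibration γ)) : Prop :=
  ∀ (c : ℝ → CarnotPath H) (v : TangentSpace (𝓡 n) (fibration γ)), RepresentsOver c γ v →
    HasDerivAt (fun s : ℝ => actionCC ψ (c s)) (α v : ℝ) 0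

/-- The horizontal derivative `D^h A_H^{CC}(γ)` (meaningful where it exists and is unique). -/
def horizontalDerivative (ψ : ℝ → J1 n B ≃ J1 n B) (γ : CarnotPath H) :
    CotangentFibre n B (fibration γ) :=
  Classical.epsilon (IsHorizontalDerivative ψ γ)

/-- The map `i = j^1 A_H^{CC} : Σ → J^1B`,
`γ ↦ (Π(γ), D^h A_H^{CC}(γ), A_H^{CC}(γ))`. -/
def jetMap (ψ : ℝ → J1 n B ≃ J1 n B) (γ : verticalCriticalSet H ψ) : J1 n B :=
  (⟨fibration γ.1, horizontalDerivative ψ γ.1⟩, actionCC ψ γ.1)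

end OneJet

end

/-! On `CarnotPath H` the integrand of the action vanishes, so the action is just z(γ(1)). The task
is to see which velocities η of the end point γ(1) are realized by families in the path space.

The basic tool is a linear equation. For a family c(s,t) with λ(∂ₜc) = -H whose member c(0,·) is a
Hamiltonian trajectory, a(t) = λ(∂ₛc(0,t)) satisfies a' = -R[H]·a, by Cartan's formula for dλ(∂ₜ,∂ₛ)
and Hamilton's equation. So a vanishes identically once it vanishes at one time
(`contactForm_variation_eq_zero`). Applied to the flow, this shows that ψ^t preserves ker λ; hence
u(t) = (ψ^t)⁻¹(γ(t)) turns paths with λ(γ') + H = 0 into paths tangent to ker λ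
(`IsContactHamiltonianFlow.isHorizontal_iff`).

Critical paths are trajectories. In canonical coordinates a horizontal curve is a curve (q,p)
together with z = ∫ p dq. If the first variation of ∫ p dq were nonzero for some ξ vanishing near
the start and at time 1, the end point of u could be moved to first order in every direction. In
particular γ(1) could be moved along the Reeb field, where dΠ = 0 and dz = 1, against criticality.
So the first variation vanishes, and the Euler-Lagrange equations q' = p' = 0 with horizontality
make u constant (`ext_eq_flow_of_mem_verticalCriticalSet`).

Conversely, along a trajectory from the zero section, a(0) = 0 because the zero section is
Legendrian, so a(1) = 0, that is dz(η) = p(dπ_B(η)). Hence p is a horizontal derivative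
(`isHorizontalDerivative_momentum`). It is the only one because every base velocity is realized
(`exists_representsOver`). Thus i(γ) = γ(1) = ψ^1(γ(0)), and the remaining claims follow. -/

noncomputable section

namespace OneJet

/-! ### The contact form in bundle charts -/

section Coordinates

variable {n : ℕ} {B : Type*} [TopologicalSpace B] [ChartedSpace (Model n) B]
  [IsManifold (𝓡 n) ∞ B]


/-- The standard contact form `dz - p dq` on the model space. -/
def stdForm (x : J1Space n) : J1Space n →L[ℝ] ℝ :=
  ContinuousLinearMap.snd ℝ (Model n × (Model n →L[ℝ] ℝ)) ℝ -
    x.1.2.comp ((ContinuousLinearMap.fst ℝ (Model n) (Model n →L[ℝ] ℝ)).comp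
      (ContinuousLinearMap.fst ℝ (Model n × (Model n →L[ℝ] ℝ)) ℝ))

@[simp] lemma stdForm_apply (x v : J1Space n) : stdForm x v = v.2 - x.1.2 v.1.1 := rfl

lemma extChartAt_source_iff (y₀ y : J1 n B) :
    y ∈ (extChartAt (J1Model n) y₀).source ↔ toBase y ∈ (chartAt (Model n) (toBase y₀)).source := by
  rw [extChartAt_prod, PartialEquiv.prod_source, FiberBundle.extChartAt]
  simp only [toBase, PartialEquiv.trans_source, PartialEquiv.prod_source, PartialEquiv.refl_source,
    extChartAt_source, mem_prod, mem_inter_iff, mem_preimage, mem_univ, and_true, chartAt_self_eq,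
    OpenPartialHomeomorph.refl_source]
  exact ⟨fun h => h.2, fun h => ⟨⟨h, trivial⟩, h⟩⟩

lemma extChartAt_fst_fst (y₀ y : J1 n B) :
    (extChartAt (J1Model n) y₀ y).1.1 = extChartAt (𝓡 n) (toBase y₀) (toBase y) := by
  rw [extChartAt_prod, FiberBundle.extChartAt]
  rfl

lemma extChartAt_snd (y₀ y : J1 n B) : (extChartAt (J1Model n) y₀ y).2 = y.2 := by
  rw [extChartAt_prod]
  rfl

/-- The cotangent trivialization is dual to the tangent one, and the latter is the differential of
the base chart; so the pairing of p with tangent vectors is independent of coordinates. -/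
lemma extChartAt_fst_snd (y₀ y : J1 n B) (hy : y ∈ (extChartAt (J1Model n) y₀).source)
    (w : TangentSpace (𝓡 n) (toBase y)) :
    (extChartAt (J1Model n) y₀ y).1.2 (mvfderiv (𝓡 n) (extChartAt (𝓡 n) (toBase y₀)) (toBase y) w) =
      momentum y w := by
  rw [extChartAt_source_iff] at hy
  rw [extChartAt_prod, FiberBundle.extChartAt]
  have h1 : ((trivializationAt (Model n →L[ℝ] ℝ) (CotangentFibre n B) y₀.1.proj) y.1).2 =
      y.1.2.comp ((trivializationAt (Model n) (TangentSpace (𝓡 n)) y₀.1.proj).symmL ℝ y.1.proj) := by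
    rw [hom_trivializationAt_apply]
    ext v
    simp [ContinuousLinearMap.inCoordinates]
  change ((trivializationAt (Model n →L[ℝ] ℝ) (CotangentFibre n B) y₀.1.proj) y.1).2 _ = _
  rw [h1]
  have h2 := (trivializationAt (Model n) (TangentSpace (𝓡 n) (M := B))
    y₀.1.proj).symmL_continuousLinearMapAt (R := ℝ) (b := y.1.proj) hy w
  rw [show (trivializationAt (Model n) (TangentSpace (𝓡 n) (M := B))
    y₀.1.proj).continuousLinearMapAt ℝ y.1.proj = _ from
    TangentBundle.continuousLinearMapAt_trivializationAt hy] at h2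
  exact congrArg (y.1.2) h2

lemma mdifferentiable_toBase : MDifferentiable (J1Model n) (𝓡 n) (toBase : J1 n B → B) := fun y =>
  (((contMDiff_proj (CotangentFibre n B) (n := ∞)).comp contMDiff_fst).mdifferentiable (by simp)) y

lemma mdifferentiable_zCoord : MDifferentiable (J1Model n) 𝓘(ℝ, ℝ) (zCoord : J1 n B → ℝ) := fun y =>
  ((contMDiff_snd (n := ∞)).mdifferentiable (by simp)) y

lemma mdifferentiableAt_chart {y₀ y : J1 n B} (hy : y ∈ (extChartAt (J1Model n) y₀).source) :
    MDifferentiableAt (J1Model n) 𝓘(ℝ, J1Space n) (extChartAt (J1Model n) y₀) y :=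
  mdifferentiableAt_extChartAt (by rwa [extChartAt_source] at hy)

section CLM

variable {E M H₀ V F : Type*} [NormedAddCommGroup E] [NormedSpace ℝ E] [TopologicalSpace H₀]
  {I : ModelWithCorners ℝ E H₀} [TopologicalSpace M] [ChartedSpace H₀ M]
  [NormedAddCommGroup V] [NormedSpace ℝ V] [NormedAddCommGroup F] [NormedSpace ℝ F]

lemma mvfderiv_clm_comp (L : V →L[ℝ] F) {f : M → V} {x : M}
    (hf : MDifferentiableAt I 𝓘(ℝ, V) f x) (v : TangentSpace I x) :
    mvfderiv I (fun y => L (f y)) x v = L (mvfderiv I f x v) := by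
  have h := mfderiv_comp (I' := 𝓘(ℝ, V)) (I'' := 𝓘(ℝ, F)) (g := L) x
    L.differentiableAt.mdifferentiableAt hf
  have h3 := DFunLike.congr_fun h v
  rw [mfderiv_eq_fderiv] at h3
  erw [L.fderiv] at h3
  exact h3

end CLM

lemma mvfderiv_chart_mfderiv_toBase {y₀ y : J1 n B}
    (hy : y ∈ (extChartAt (J1Model n) y₀).source) (v : TangentSpace (J1Model n) y) :
    mvfderiv (𝓡 n) (extChartAt (𝓡 n) (toBase y₀)) (toBase y)
      (mfderiv (J1Model n) (𝓡 n) toBase y v) =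
      (mvfderiv (J1Model n) (extChartAt (J1Model n) y₀) y v).1.1 := by
  have hχ := mdifferentiableAt_chart hy
  have hb : toBase y ∈ (chartAt (Model n) (toBase y₀)).source := (extChartAt_source_iff _ _).1 hy
  refine Eq.trans ?_ (mvfderiv_clm_comp ((ContinuousLinearMap.fst ℝ (Model n)
    (Model n →L[ℝ] ℝ)).comp (ContinuousLinearMap.fst ℝ (Model n × (Model n →L[ℝ] ℝ)) ℝ)) hχ v)
  have h := mfderiv_comp y (mdifferentiableAt_extChartAt hb) (mdifferentiable_toBase y)
  refine (DFunLike.congr_fun h v).symm.trans ?_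
  exact congrArg (fun f => mvfderiv (J1Model n) f y v)
    (funext fun y => (extChartAt_fst_fst _ _).symm)

/-- Bundle charts are canonical coordinates (q, p, z). Every later computation with λ passes through
this identity. -/
lemma contactForm_eq_stdForm {y₀ y : J1 n B} (hy : y ∈ (extChartAt (J1Model n) y₀).source)
    (v : TangentSpace (J1Model n) y) :
    contactForm y v = stdForm (extChartAt (J1Model n) y₀ y)
      (mvfderiv (J1Model n) (extChartAt (J1Model n) y₀) y v) := by
  have hχ := mdifferentiableAt_chart hy
  have hz : mvfderiv (J1Model n) zCoord y v =
      (mvfderiv (J1Model n) (extChartAt (J1Model n) y₀) y v).2 := by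
    refine Eq.trans ?_ (mvfderiv_clm_comp (ContinuousLinearMap.snd ℝ
      (Model n × (Model n →L[ℝ] ℝ)) ℝ) hχ v)
    exact congrArg (fun f => mvfderiv (J1Model n) f y v) (funext fun y => (extChartAt_snd _ _).symm)
  rw [stdForm_apply, ← hz, ← mvfderiv_chart_mfderiv_toBase hy, extChartAt_fst_snd _ _ hy]
  rfl

lemma mvfderiv_chart_symm (y₀ : J1 n B) {x : J1Space n}
    (hx : x ∈ (extChartAt (J1Model n) y₀).target) (v : J1Space n) :
    mvfderiv (J1Model n) (extChartAt (J1Model n) y₀) ((extChartAt (J1Model n) y₀).symm x)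
      (mfderiv 𝓘(ℝ, J1Space n) (J1Model n) (extChartAt (J1Model n) y₀).symm x
        ((NormedSpace.fromTangentSpace (𝕜 := ℝ) x).symm v)) = v := by
  have h := mfderiv_extChartAt_comp_mfderivWithin_extChartAt_symm hx
  rw [ModelWithCorners.range_eq_univ, mfderivWithin_univ] at h
  exact DFunLike.congr_fun h v

lemma contactFormInChart_eq_stdForm (y₀ : J1 n B) {x : J1Space n}
    (hx : x ∈ (extChartAt (J1Model n) y₀).target) : contactFormInChart y₀ x = stdForm x := by
  refine ContinuousLinearMap.ext fun v => ?_
  have hs := (extChartAt (J1Model n) y₀).map_target hx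
  refine (contactForm_eq_stdForm hs _).trans ?_
  rw [PartialEquiv.right_inv _ hx]
  exact congrArg _ (mvfderiv_chart_symm y₀ hx v)

lemma hasFDerivAt_sub_comp {V W : Type*} [NormedAddCommGroup V] [NormedSpace ℝ V]
    [NormedAddCommGroup W] [NormedSpace ℝ W] (s : V →L[ℝ] ℝ) (P : V →L[ℝ] W →L[ℝ] ℝ)
    (L : V →L[ℝ] W) (x : V) :
    HasFDerivAt (fun x => s - (P x).comp L)
      (-((ContinuousLinearMap.compL ℝ V W ℝ).flip L).comp P) x :=
  (((ContinuousLinearMap.compL ℝ V W ℝ).flip L).comp P).hasFDerivAt.const_sub s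

instance : AddCommGroup (J1Space n →L[ℝ] ℝ) := ContinuousLinearMap.addCommGroup

instance : NormedAddCommGroup (J1Space n →L[ℝ] ℝ) := ContinuousLinearMap.toNormedAddCommGroup

lemma exists_hasFDerivAt_stdForm (x : J1Space n) : ∃ D : J1Space n →L[ℝ] J1Space n →L[ℝ] ℝ,
    HasFDerivAt (stdForm (n := n)) D x ∧ ∀ u v, D u v = - u.1.2 v.1.1 :=
  ⟨_, hasFDerivAt_sub_comp (ContinuousLinearMap.snd ℝ (Model n × (Model n →L[ℝ] ℝ)) ℝ)
    ((ContinuousLinearMap.snd ℝ (Model n) (Model n →L[ℝ] ℝ)).comp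
        (ContinuousLinearMap.fst ℝ (Model n × (Model n →L[ℝ] ℝ)) ℝ))
    ((ContinuousLinearMap.fst ℝ (Model n) (Model n →L[ℝ] ℝ)).comp
        (ContinuousLinearMap.fst ℝ (Model n × (Model n →L[ℝ] ℝ)) ℝ)) x, fun _ _ => rfl⟩

lemma fderiv_stdForm (x u v : J1Space n) :
    fderiv ℝ (stdForm (n := n)) x u v = - u.1.2 v.1.1 := by
  obtain ⟨D, hD, h⟩ := exists_hasFDerivAt_stdForm x
  rw [hD.fderiv, h]

lemma dContactForm_eq (y : J1 n B) (u v : TangentSpace (J1Model n) y) :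
    dContactForm y u v =
      (mvfderiv (J1Model n) (extChartAt (J1Model n) y) y v).1.2
        (mvfderiv (J1Model n) (extChartAt (J1Model n) y) y u).1.1 -
      (mvfderiv (J1Model n) (extChartAt (J1Model n) y) y u).1.2
        (mvfderiv (J1Model n) (extChartAt (J1Model n) y) y v).1.1 := by
  have h : contactFormInChart y =ᶠ[nhds (extChartAt (J1Model n) y y)] stdForm :=
    Filter.eventuallyEq_of_mem ((isOpen_extChartAt_target y).mem_nhds (mem_extChartAt_target y))
      fun x hx => contactFormInChart_eq_stdForm y hx
  simp only [dContactForm, h.fderiv_eq, fderiv_stdForm]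
  ring

lemma mvfderiv_chart_velocity {y₀ : J1 n B} {f : ℝ → J1 n B} {S : Set ℝ} {t : ℝ}
    (hf : MDifferentiableWithinAt 𝓘(ℝ, ℝ) (J1Model n) f S t) (hS : UniqueDiffWithinAt ℝ S t)
    (hy : f t ∈ (extChartAt (J1Model n) y₀).source) :
    mvfderiv (J1Model n) (extChartAt (J1Model n) y₀) (f t)
      (mfderivWithin 𝓘(ℝ, ℝ) (J1Model n) f S t (unitTangent t)) =
      derivWithin (fun r => extChartAt (J1Model n) y₀ (f r)) S t := by
  have h := mfderiv_comp_mfderivWithin t (mdifferentiableAt_chart hy) hf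
    hS.uniqueMDiffWithinAt
  have h2 := DFunLike.congr_fun h (unitTangent t)
  rw [mfderivWithin_eq_fderivWithin] at h2
  exact h2.symm

lemma contactForm_velocity {y₀ : J1 n B} {f : ℝ → J1 n B} {S : Set ℝ} {t : ℝ}
    (hf : MDifferentiableWithinAt 𝓘(ℝ, ℝ) (J1Model n) f S t) (hS : UniqueDiffWithinAt ℝ S t)
    (hy : f t ∈ (extChartAt (J1Model n) y₀).source) :
    contactForm (f t) (mfderivWithin 𝓘(ℝ, ℝ) (J1Model n) f S t (unitTangent t)) =
      stdForm (extChartAt (J1Model n) y₀ (f t))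
        (derivWithin (fun r => extChartAt (J1Model n) y₀ (f r)) S t) := by
  rw [contactForm_eq_stdForm hy, mvfderiv_chart_velocity hf hS hy]

end Coordinates

/-! ### The linear equation for the pairing of λ with a variation -/

section VariationEquation

section Calculus

variable {V : Type*} [NormedAddCommGroup V] [NormedSpace ℝ V]

/-- Chain and product rule along a curve `g` of velocity `w`. The two mixed derivatives of the next
lemma are the cases where `e` and `w` exchange roles. -/
lemma hasDerivWithinAt_pairing {Λ : V → V →L[ℝ] ℝ} {C : ℝ × ℝ → V} {Ω : Set (ℝ × ℝ)}
    {p : ℝ × ℝ} {Λ' : V →L[ℝ] V →L[ℝ] ℝ} {D' : ℝ × ℝ →L[ℝ] ℝ × ℝ →L[ℝ] V}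
    (hΛ : HasFDerivAt Λ Λ' (C p)) (hC : DifferentiableWithinAt ℝ C Ω p)
    (hD : HasFDerivWithinAt (fderivWithin ℝ C Ω) D' Ω p) (e w : ℝ × ℝ)
    {g : ℝ → ℝ × ℝ} {r : ℝ} {S : Set ℝ} (hgr : g r = p) (hg : HasDerivWithinAt g w S r)
    (hS : MapsTo g S Ω) :
    HasDerivWithinAt (fun q => Λ (C (g q)) (fderivWithin ℝ C Ω (g q) e))
      (Λ' (fderivWithin ℝ C Ω p w) (fderivWithin ℝ C Ω p e) + Λ (C p) (D' w e)) S r := by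
  subst hgr
  have h1 := hC.hasFDerivWithinAt.comp_hasDerivWithinAt r hg hS
  have h2 := hΛ.comp_hasDerivWithinAt r h1
  have h3 := (hD.comp_hasDerivWithinAt r hg hS).clm_apply (hasDerivWithinAt_const r S e)
  simpa using h2.clm_apply h3

/-- Cartan's formula ∂ₜ(Λ(∂ₛC)) - ∂ₛ(Λ(∂ₜC)) = dΛ(∂ₜC, ∂ₛC): the second derivatives of C cancel by
symmetry. The number `b` is ∂ₛ(Λ(∂ₜC)). -/
lemma exists_hasDerivWithinAt_mixed {Λ : V → V →L[ℝ] ℝ} {C : ℝ × ℝ → V} {δ t : ℝ} (hδ : 0 < δ)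
    (ht : t ∈ Icc (0 : ℝ) 1) {Λ' : V →L[ℝ] V →L[ℝ] ℝ}
    (hC : ContDiffWithinAt ℝ ∞ C (Ioo (-δ) δ ×ˢ Icc 0 1) (0, t))
    (hΛ : HasFDerivAt Λ Λ' (C (0, t))) :
    ∃ b : ℝ, HasDerivAt (fun s => Λ (C (s, t))
        (fderivWithin ℝ C (Ioo (-δ) δ ×ˢ Icc 0 1) (s, t) (0, 1))) b 0 ∧
      HasDerivWithinAt (fun r => Λ (C (0, r))
        (fderivWithin ℝ C (Ioo (-δ) δ ×ˢ Icc 0 1) (0, r) (1, 0)))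
        (b + Λ' (fderivWithin ℝ C (Ioo (-δ) δ ×ˢ Icc 0 1) (0, t) (0, 1))
            (fderivWithin ℝ C (Ioo (-δ) δ ×ˢ Icc 0 1) (0, t) (1, 0))
          - Λ' (fderivWithin ℝ C (Ioo (-δ) δ ×ˢ Icc 0 1) (0, t) (1, 0))
            (fderivWithin ℝ C (Ioo (-δ) δ ×ˢ Icc 0 1) (0, t) (0, 1))) (Icc 0 1) t := by
  set Ω := Ioo (-δ) δ ×ˢ Icc (0 : ℝ) 1 with hΩ
  have h0 : (0 : ℝ) ∈ Ioo (-δ) δ := ⟨by linarith, hδ⟩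
  have hp : ((0 : ℝ), t) ∈ Ω := ⟨h0, ht⟩
  have hU : UniqueDiffOn ℝ Ω := (uniqueDiffOn_Ioo _ _).prod (uniqueDiffOn_Icc zero_lt_one)
  -- Being a limit of interior points gives symmetry of the second derivative also at the boundary
  -- times t = 0 and t = 1.
  have hcl : ((0 : ℝ), t) ∈ closure (interior Ω) := by
    rw [hΩ, interior_prod_eq, closure_prod_eq, interior_Icc, closure_Ioo zero_ne_one]
    exact ⟨subset_closure (by rwa [interior_Ioo]), ht⟩
  have hsymm := hC.isSymmSndFDerivWithinAt (by simpa using (by exact WithTop.coe_le_coe.2 le_top : (2 : ℕ∞ω) ≤ ∞)) hU hcl hp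
  have hD := ((hC.fderivWithin_right (m := 1) hU (by exact WithTop.coe_le_coe.2 le_top) hp).differentiableWithinAt
    (by simp)).hasFDerivWithinAt
  have hCd := hC.differentiableWithinAt (by simp)
  have hs : HasDerivWithinAt (fun s : ℝ => (s, t)) ((1 : ℝ), (0 : ℝ)) (Ioo (-δ) δ) 0 :=
    ((hasDerivAt_id _).prodMk (hasDerivAt_const _ _)).hasDerivWithinAt
  have hr : HasDerivWithinAt (fun r : ℝ => ((0 : ℝ), r)) ((0 : ℝ), (1 : ℝ)) (Icc 0 1) t :=
    ((hasDerivAt_const _ _).prodMk (hasDerivAt_id _)).hasDerivWithinAt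
  refine ⟨_, (hasDerivWithinAt_pairing hΛ hCd hD (0, 1) (1, 0)
    (g := fun s => (s, t)) rfl hs fun s hs => ⟨hs, ht⟩).hasDerivAt (isOpen_Ioo.mem_nhds h0), ?_⟩
  convert! hasDerivWithinAt_pairing hΛ hCd hD (1, 0) (0, 1)
    (g := fun r => (0, r)) rfl hr (fun r hr => ⟨h0, hr⟩) using 1
  rw [hsymm.eq (0, 1) (1, 0)]
  ring

lemma hasDerivWithinAt_slice_snd {C : ℝ × ℝ → V} {I J : Set ℝ} {s t : ℝ}
    (hC : DifferentiableWithinAt ℝ C (I ×ˢ J) (s, t)) (hs : s ∈ I) :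
    HasDerivWithinAt (fun r => C (s, r)) (fderivWithin ℝ C (I ×ˢ J) (s, t) (0, 1)) J t :=
  hC.hasFDerivWithinAt.comp_hasDerivWithinAt t
    ((hasDerivAt_const t s).prodMk (hasDerivAt_id t)).hasDerivWithinAt fun _ hr => ⟨hs, hr⟩

lemma hasDerivWithinAt_slice_fst {C : ℝ × ℝ → V} {I J : Set ℝ} {s t : ℝ}
    (hC : DifferentiableWithinAt ℝ C (I ×ˢ J) (s, t)) (ht : t ∈ J) :
    HasDerivWithinAt (fun r => C (r, t)) (fderivWithin ℝ C (I ×ˢ J) (s, t) (1, 0)) I s :=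
  hC.hasFDerivWithinAt.comp_hasDerivWithinAt (f := fun r => (r, t)) s
    ((hasDerivAt_id s).prodMk (hasDerivAt_const s t)).hasDerivWithinAt fun _ hr => ⟨hr, ht⟩

end Calculus

variable {n : ℕ} {B : Type*} [TopologicalSpace B] [ChartedSpace (Model n) B]
  [IsManifold (𝓡 n) ∞ B]

lemma contMDiffWithinAt_prod_self_iff {V : Type*} [NormedAddCommGroup V] [NormedSpace ℝ V]
    {f : ℝ × ℝ → V} {S : Set (ℝ × ℝ)} {x : ℝ × ℝ} {m : ℕ∞ω} :
    ContMDiffWithinAt (𝓘(ℝ, ℝ).prod 𝓘(ℝ, ℝ)) 𝓘(ℝ, V) m f S x ↔ ContDiffWithinAt ℝ m f S x := by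
  rw [← contMDiffWithinAt_iff_contDiffWithinAt, ← modelWithCornersSelf_prod,
    ← chartedSpaceSelf_prod]

lemma contMDiffAt_chart {y₀ y : J1 n B} (hy : y ∈ (extChartAt (J1Model n) y₀).source) :
    ContMDiffAt (J1Model n) 𝓘(ℝ, J1Space n) ∞ (extChartAt (J1Model n) y₀) y :=
  contMDiffAt_extChartAt' (by rwa [extChartAt_source] at hy)

lemma IsSmoothHamiltonian.contMDiff {H : ℝ → J1 n B → ℝ} (hH : IsSmoothHamiltonian H) {t : ℝ}
    (ht : t ∈ Icc (0 : ℝ) 1) : ContMDiff (J1Model n) 𝓘(ℝ, ℝ) ∞ (H t) := by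
  rw [← contMDiffOn_univ]
  exact hH.comp ((contMDiff_const.prodMk contMDiff_id).contMDiffOn) fun y _ => ⟨ht, mem_univ y⟩

section Family

variable {c : ℝ → ℝ → J1 n B} {I J : Set ℝ}

lemma contMDiffOn_slice_snd (hc : ContMDiffOn (𝓘(ℝ, ℝ).prod 𝓘(ℝ, ℝ)) (J1Model n) ∞
    (fun x : ℝ × ℝ => c x.1 x.2) (I ×ˢ J)) {s : ℝ} (hs : s ∈ I) :
    ContMDiffOn 𝓘(ℝ, ℝ) (J1Model n) ∞ (c s) J :=
  hc.comp ((contMDiff_const.prodMk contMDiff_id).contMDiffOn) fun _ h => ⟨hs, h⟩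

lemma contMDiffOn_slice_fst (hc : ContMDiffOn (𝓘(ℝ, ℝ).prod 𝓘(ℝ, ℝ)) (J1Model n) ∞
    (fun x : ℝ × ℝ => c x.1 x.2) (I ×ˢ J)) {t : ℝ} (ht : t ∈ J) :
    ContMDiffOn 𝓘(ℝ, ℝ) (J1Model n) ∞ (fun s => c s t) I :=
  hc.comp ((contMDiff_id.prodMk contMDiff_const).contMDiffOn) fun _ h => ⟨h, ht⟩

lemma contDiffWithinAt_chart_comp (hc : ContMDiffOn (𝓘(ℝ, ℝ).prod 𝓘(ℝ, ℝ)) (J1Model n) ∞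
    (fun x : ℝ × ℝ => c x.1 x.2) (I ×ˢ J)) {y₀ : J1 n B} {s t : ℝ} (hs : s ∈ I) (ht : t ∈ J)
    (hy : c s t ∈ (extChartAt (J1Model n) y₀).source) :
    ContDiffWithinAt ℝ ∞ (fun x : ℝ × ℝ => extChartAt (J1Model n) y₀ (c x.1 x.2)) (I ×ˢ J)
      (s, t) := by
  rw [← contMDiffWithinAt_prod_self_iff]
  exact (contMDiffAt_chart hy).comp_contMDiffWithinAt (s, t) (hc (s, t) ⟨hs, ht⟩)

end Family

/-- Along a family of paths with `λ(∂ₜ) = -H` which starts at a solution of Hamilton's equation,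
the pairing of `λ` with the variation solves a homogeneous linear equation. -/
lemma hasDerivWithinAt_contactForm_variation {H : ℝ → J1 n B → ℝ} (hH : IsSmoothHamiltonian H)
    {c : ℝ → ℝ → J1 n B} {δ : ℝ} (hδ : 0 < δ)
    (hc : ContMDiffOn (𝓘(ℝ, ℝ).prod 𝓘(ℝ, ℝ)) (J1Model n) ∞
      (fun x : ℝ × ℝ => c x.1 x.2) (Ioo (-δ) δ ×ˢ Icc 0 1))
    (heq : ∀ s ∈ Ioo (-δ) δ, ∀ t ∈ Icc (0 : ℝ) 1, contactForm (c s t)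
      (mfderivWithin 𝓘(ℝ, ℝ) (J1Model n) (c s) (Icc 0 1) t (unitTangent t)) = - H t (c s t))
    {t : ℝ} (ht : t ∈ Icc (0 : ℝ) 1)
    (hX : IsContactHamiltonianVector (H t) (c 0 t)
      (mfderivWithin 𝓘(ℝ, ℝ) (J1Model n) (c 0) (Icc 0 1) t (unitTangent t))) :
    HasDerivWithinAt (fun r => contactForm (c 0 r)
        (mfderiv 𝓘(ℝ, ℝ) (J1Model n) (fun s => c s r) 0 (unitTangent 0)))
      (-(mvfderiv (J1Model n) (H t) (c 0 t) (reeb (c 0 t))) * contactForm (c 0 t)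
        (mfderiv 𝓘(ℝ, ℝ) (J1Model n) (fun s => c s t) 0 (unitTangent 0))) (Icc 0 1) t := by
  have h0 : (0 : ℝ) ∈ Ioo (-δ) δ := ⟨by linarith, hδ⟩
  set y₀ := c 0 t with hy₀
  set χ := extChartAt (J1Model n) y₀
  have hy : y₀ ∈ χ.source := mem_extChartAt_source y₀
  set C : ℝ × ℝ → J1Space n := fun x => χ (c x.1 x.2) with hCdef
  have hopen : IsOpen χ.source := isOpen_extChartAt_source y₀
  have hC : ∀ s ∈ Ioo (-δ) δ, ∀ r ∈ Icc (0 : ℝ) 1, c s r ∈ χ.source →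
      ContDiffWithinAt ℝ ∞ C (Ioo (-δ) δ ×ˢ Icc 0 1) (s, r) := fun s hs r hr h =>
    contDiffWithinAt_chart_comp hc hs hr h
  have hmt : ∀ s ∈ Ioo (-δ) δ, ∀ r ∈ Icc (0 : ℝ) 1,
      MDifferentiableWithinAt 𝓘(ℝ, ℝ) (J1Model n) (c s) (Icc 0 1) r := fun s hs r hr =>
    (contMDiffOn_slice_snd hc hs).mdifferentiableOn (by simp) r hr
  have hms : ∀ r ∈ Icc (0 : ℝ) 1, MDifferentiableAt 𝓘(ℝ, ℝ) (J1Model n) (fun s => c s r) 0 :=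
    fun r hr => ((contMDiffOn_slice_fst hc hr).mdifferentiableOn (by simp) 0 h0).mdifferentiableAt
      (isOpen_Ioo.mem_nhds h0)
  have hdt : ∀ s ∈ Ioo (-δ) δ, ∀ r ∈ Icc (0 : ℝ) 1, c s r ∈ χ.source →
      derivWithin (fun q => χ (c s q)) (Icc 0 1) r =
        fderivWithin ℝ C (Ioo (-δ) δ ×ˢ Icc 0 1) (s, r) (0, 1) := fun s hs r hr h =>
    (hasDerivWithinAt_slice_snd ((hC s hs r hr h).differentiableWithinAt (by simp))
      hs).derivWithin (uniqueDiffOn_Icc zero_lt_one r hr)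
  have hds : ∀ r ∈ Icc (0 : ℝ) 1, c 0 r ∈ χ.source → mvfderiv (J1Model n) χ (c 0 r)
      (mfderiv 𝓘(ℝ, ℝ) (J1Model n) (fun s => c s r) 0 (unitTangent 0)) =
      fderivWithin ℝ C (Ioo (-δ) δ ×ˢ Icc 0 1) (0, r) (1, 0) := fun r hr h => by
    have h1 := mvfderiv_chart_velocity (f := fun s => c s r) (S := univ)
      (hms r hr).mdifferentiableWithinAt uniqueDiffWithinAt_univ h
    rw [mfderivWithin_univ, derivWithin_univ] at h1
    rw [h1]
    exact ((hasDerivWithinAt_slice_fst ((hC 0 h0 r hr h).differentiableWithinAt (by simp))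
      hr).hasDerivAt (isOpen_Ioo.mem_nhds h0)).deriv
  obtain ⟨Λ', hΛ', hΛ'eq⟩ := exists_hasFDerivAt_stdForm (C (0, t))
  obtain ⟨b, hb, ha⟩ := exists_hasDerivWithinAt_mixed hδ ht (hC 0 h0 t ht hy) hΛ'
  -- Since λ(∂ₜc) = -H along the whole family, `b` is the s-derivative of -H.
  have hb' : HasDerivAt (fun s => -H t (c s t)) b 0 := by
    refine hb.congr_of_eventuallyEq ?_
    filter_upwards [isOpen_Ioo.mem_nhds h0,
      (hms t ht).continuousAt.preimage_mem_nhds (hopen.mem_nhds hy)] with s hs hsy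
    rw [← heq s hs t ht, contactForm_velocity (hmt s hs t ht)
      (uniqueDiffOn_Icc zero_lt_one t ht) hsy, hdt s hs t ht hsy]
  have hHm := ((hH.contMDiff ht).mdifferentiable (by simp)) y₀
  have hb2 : mvfderiv (J1Model n) (H t) y₀
      (mfderiv 𝓘(ℝ, ℝ) (J1Model n) (fun s => c s t) 0 (unitTangent 0)) = - b := by
    have h1 := mfderiv_comp_apply 0 (I' := J1Model n) hHm (hms t ht) (unitTangent 0)
    rw [mfderiv_eq_fderiv] at h1
    have h2 : deriv (fun s => H t (c s t)) 0 = -b := by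
      simpa using hb'.neg.deriv
    exact h1.symm.trans h2
  have ha' := ha.congr_of_eventuallyEq (f₁ := fun r => contactForm (c 0 r)
        (mfderiv 𝓘(ℝ, ℝ) (J1Model n) (fun s => c s r) 0 (unitTangent 0))) ?_ ?_
  · refine ha'.congr_deriv ?_
    -- Hamilton's equation evaluated on ∂ₛc: here dH(∂ₛc) = -b, so b + dλ(∂ₜc, ∂ₛc) collapses to
    -- -R[H]·λ(∂ₛc).
    have hX2 := hX.2 (mfderiv 𝓘(ℝ, ℝ) (J1Model n) (fun s => c s t) 0 (unitTangent 0))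
    rw [hb2, dContactForm_eq, hds t ht hy, mvfderiv_chart_velocity (hmt 0 h0 t ht)
      (uniqueDiffOn_Icc zero_lt_one t ht) hy, hdt 0 h0 t ht hy] at hX2
    rw [hΛ'eq, hΛ'eq]
    linarith
  · filter_upwards [self_mem_nhdsWithin,
      (hmt 0 h0 t ht).continuousWithinAt.preimage_mem_nhdsWithin (hopen.mem_nhds hy)] with r hr hry
    rw [contactForm_eq_stdForm hry, hds r hr hry]
  · rw [contactForm_eq_stdForm hy, hds t ht hy]

end VariationEquation

/-! ### The flow preserves the contact hyperplanes -/

section FlowPreservesContact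

/-- The integrating factor exp(-∫ρ) turns a into a constant, so a zero at one time propagates both
forwards and backwards. -/
lemma eq_zero_of_hasDerivWithinAt_linear {a ρ : ℝ → ℝ} (hρ : ContinuousOn ρ (Icc 0 1))
    (ha : ∀ t ∈ Icc (0 : ℝ) 1, HasDerivWithinAt a (ρ t * a t) (Icc 0 1) t) {t₁ : ℝ}
    (ht₁ : t₁ ∈ Icc (0 : ℝ) 1) (h₁ : a t₁ = 0) : ∀ t ∈ Icc (0 : ℝ) 1, a t = 0 := by
  -- Extending ρ continuously to the line makes its primitive differentiable at the end points as
  -- well.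
  set r : ℝ → ℝ := IccExtend zero_le_one ((Icc (0 : ℝ) 1).domRestrict ρ)
  have hr : Continuous r := (continuousOn_iff_continuous_domRestrict.1 hρ).Icc_extend'
  set b : ℝ → ℝ := fun t => a t * Real.exp (-∫ x in (0 : ℝ)..t, r x)
  have hb : ∀ t ∈ Icc (0 : ℝ) 1, HasDerivWithinAt b 0 (Icc 0 1) t := fun t ht => by
    have h2 := (hr.integral_hasStrictDerivAt 0 t).hasDerivAt.neg.exp.hasDerivWithinAt (s := Icc 0 1)
    have h3 : r t = ρ t := IccExtend_of_mem _ _ ht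
    refine ((ha t ht).mul h2).congr_deriv ?_
    rw [h3]
    ring
  have hconst := constant_of_derivWithin_zero (fun t ht => (hb t ht).differentiableWithinAt)
    fun t ht => (hb t (Ico_subset_Icc_self ht)).derivWithin
      (uniqueDiffOn_Icc zero_lt_one t (Ico_subset_Icc_self ht))
  intro t ht
  have h := (hconst t ht).trans (hconst t₁ ht₁).symm
  simp only [b, h₁, zero_mul, mul_eq_zero, Real.exp_ne_zero, or_false] at h
  exact h

variable {n : ℕ} {B : Type*} [TopologicalSpace B] [ChartedSpace (Model n) B]
  [IsManifold (𝓡 n) ∞ B]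

lemma mvfderiv_reeb {h : J1 n B → ℝ} {y : J1 n B} (hh : MDifferentiableAt (J1Model n) 𝓘(ℝ, ℝ) h y) :
    mvfderiv (J1Model n) h y (reeb y) = deriv (fun r : ℝ => h (y.1, y.2 + r)) 0 := by
  have hg : MDifferentiableAt 𝓘(ℝ, ℝ) (J1Model n) (fun s : ℝ => ((y.1, s) : J1 n B)) y.2 :=
    mdifferentiableAt_const.prodMk mdifferentiableAt_id
  have h1 := mfderiv_comp_apply y.2 (I' := J1Model n) (f := fun s : ℝ => ((y.1, s) : J1 n B))
    (g := h) hh hg (unitTangent y.2)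
  rw [mfderiv_eq_fderiv] at h1
  have h2 : deriv (fun s : ℝ => h (y.1, s)) y.2 = deriv (fun r : ℝ => h (y.1, y.2 + r)) 0 := by
    rw [deriv_comp_const_add (fun s : ℝ => h (y.1, s)) y.2 0, add_zero]
  exact h1.symm.trans h2

/-- Supplies the continuity of the coefficient in the linear equation. The Reeb derivative is a
partial derivative at r = 0 of H(t, y(t) + r∂_z), a smooth function of (r, t) on ℝ × [0,1]. -/
lemma continuousOn_mvfderiv_reeb {H : ℝ → J1 n B → ℝ} (hH : IsSmoothHamiltonian H)
    {y : ℝ → J1 n B} (hy : ContMDiffOn 𝓘(ℝ, ℝ) (J1Model n) ∞ y (Icc 0 1)) :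
    ContinuousOn (fun t => mvfderiv (J1Model n) (H t) (y t) (reeb (y t))) (Icc 0 1) := by
  set G : ℝ × ℝ → ℝ := fun x => H x.2 ((y x.2).1, (y x.2).2 + x.1) with hG
  have hy2 : ContMDiffOn (𝓘(ℝ, ℝ).prod 𝓘(ℝ, ℝ)) (J1Model n) ∞ (fun x : ℝ × ℝ => y x.2)
      (univ ×ˢ Icc 0 1) := hy.comp contMDiffOn_snd fun x hx => hx.2
  have hGm : ContMDiffOn (𝓘(ℝ, ℝ).prod 𝓘(ℝ, ℝ)) 𝓘(ℝ, ℝ) ∞ G (univ ×ˢ Icc 0 1) := by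
    refine hH.comp (f := fun x : ℝ × ℝ => ((x.2, ((y x.2).1, (y x.2).2 + x.1)) : ℝ × J1 n B))
      (contMDiffOn_snd.prodMk ?_) fun x hx => ⟨hx.2, mem_univ _⟩
    refine ContMDiffOn.prodMk ?_ ?_
    · exact contMDiff_fst.comp_contMDiffOn hy2
    · exact (contMDiff_snd.comp_contMDiffOn hy2).add contMDiffOn_fst
  have hGd : ContDiffOn ℝ ∞ G (univ ×ˢ Icc 0 1) := fun x hx =>
    contMDiffWithinAt_prod_self_iff.1 (hGm x hx)
  have hU : UniqueDiffOn ℝ ((univ : Set ℝ) ×ˢ Icc (0 : ℝ) 1) :=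
    uniqueDiffOn_univ.prod (uniqueDiffOn_Icc zero_lt_one)
  have hcont := (hGd.continuousOn_fderivWithin hU (by simp)).clm_apply
    (continuousOn_const (c := ((1 : ℝ), (0 : ℝ))))
  have hcomp := hcont.comp (f := fun t : ℝ => ((0 : ℝ), t)) (s := Icc 0 1) (by fun_prop)
    fun t ht => ⟨mem_univ _, ht⟩
  refine hcomp.congr fun t ht => ?_
  rw [mvfderiv_reeb (((hH.contMDiff ht).mdifferentiable (by simp)) _)]
  exact (hasDerivWithinAt_univ.1 (hasDerivWithinAt_slice_fst
    ((hGd (0, t) ⟨mem_univ _, ht⟩).differentiableWithinAt (by simp)) ht)).deriv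

lemma contactForm_variation_eq_zero {H : ℝ → J1 n B → ℝ} (hH : IsSmoothHamiltonian H)
    {c : ℝ → ℝ → J1 n B} {δ : ℝ} (hδ : 0 < δ)
    (hc : ContMDiffOn (𝓘(ℝ, ℝ).prod 𝓘(ℝ, ℝ)) (J1Model n) ∞
      (fun x : ℝ × ℝ => c x.1 x.2) (Ioo (-δ) δ ×ˢ Icc 0 1))
    (heq : ∀ s ∈ Ioo (-δ) δ, ∀ t ∈ Icc (0 : ℝ) 1, contactForm (c s t)
      (mfderivWithin 𝓘(ℝ, ℝ) (J1Model n) (c s) (Icc 0 1) t (unitTangent t)) = - H t (c s t))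
    (hX : ∀ t ∈ Icc (0 : ℝ) 1, IsContactHamiltonianVector (H t) (c 0 t)
      (mfderivWithin 𝓘(ℝ, ℝ) (J1Model n) (c 0) (Icc 0 1) t (unitTangent t)))
    {t₁ : ℝ} (ht₁ : t₁ ∈ Icc (0 : ℝ) 1) (h₁ : contactForm (c 0 t₁)
        (mfderiv 𝓘(ℝ, ℝ) (J1Model n) (fun s => c s t₁) 0 (unitTangent 0)) = 0)
    {t : ℝ} (ht : t ∈ Icc (0 : ℝ) 1) : contactForm (c 0 t)
        (mfderiv 𝓘(ℝ, ℝ) (J1Model n) (fun s => c s t) 0 (unitTangent 0)) = 0 :=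
  eq_zero_of_hasDerivWithinAt_linear
    (continuousOn_mvfderiv_reeb hH (contMDiffOn_slice_snd hc (s := 0) ⟨by linarith, hδ⟩)).neg
    (fun _ ht => hasDerivWithinAt_contactForm_variation hH hδ hc heq ht (hX _ ht)) ht₁ h₁ t ht

lemma mvfderiv_chart_injective {y₀ y : J1 n B} (hy : y ∈ (extChartAt (J1Model n) y₀).source) :
    Function.Injective (mvfderiv (J1Model n) (extChartAt (J1Model n) y₀) y) := by
  have h := mfderivWithin_extChartAt_symm_comp_mfderiv_extChartAt' (I := J1Model n) hy
  exact Function.LeftInverse.injective fun v => DFunLike.congr_fun h v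

lemma mvfderiv_chart_surjective {y₀ y : J1 n B} (hy : y ∈ (extChartAt (J1Model n) y₀).source) :
    Function.Surjective (mvfderiv (J1Model n) (extChartAt (J1Model n) y₀) y) := by
  have h := mfderiv_extChartAt_comp_mfderivWithin_extChartAt_symm' (I := J1Model n) hy
  exact Function.RightInverse.surjective fun v => DFunLike.congr_fun h v

lemma tangentMap_eq_of_hasDerivAt_chart {f : ℝ → J1 n B} {y₀ y : J1 n B}
    {v : TangentSpace (J1Model n) y} (hf : MDifferentiableAt 𝓘(ℝ, ℝ) (J1Model n) f 0)
    (h0 : f 0 = y) (hy : y ∈ (extChartAt (J1Model n) y₀).source)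
    (hd : HasDerivAt (fun s => extChartAt (J1Model n) y₀ (f s))
      (mvfderiv (J1Model n) (extChartAt (J1Model n) y₀) y v) 0) :
    tangentMap 𝓘(ℝ, ℝ) (J1Model n) f ⟨0, unitTangent 0⟩ =
      (⟨y, v⟩ : TangentBundle (J1Model n) (J1 n B)) := by
  subst h0
  have h := mvfderiv_chart_velocity (S := univ) hf.mdifferentiableWithinAt
    uniqueDiffWithinAt_univ hy
  rw [derivWithin_univ, hd.deriv, mfderivWithin_univ] at h
  exact congrArg (TotalSpace.mk (f 0)) (mvfderiv_chart_injective hy h)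

/-- The curve is a straight segment in the chart. -/
lemma exists_curve_velocity (y : J1 n B) (v : TangentSpace (J1Model n) y) :
    ∃ δ > (0 : ℝ), ∃ f : ℝ → J1 n B, ContMDiffOn 𝓘(ℝ, ℝ) (J1Model n) ∞ f (Ioo (-δ) δ) ∧
      tangentMap 𝓘(ℝ, ℝ) (J1Model n) f ⟨0, unitTangent 0⟩ =
      (⟨y, v⟩ : TangentBundle (J1Model n) (J1 n B)) := by
  set χ := extChartAt (J1Model n) y with hχ
  set w : J1Space n := mvfderiv (J1Model n) χ y v with hw
  have hg : Continuous fun s : ℝ => χ y + s • w := by fun_prop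
  have hmem : (fun s : ℝ => χ y + s • w) ⁻¹' χ.target ∈ nhds (0 : ℝ) :=
    hg.continuousAt.preimage_mem_nhds ((isOpen_extChartAt_target (I := J1Model n) y).mem_nhds (by
      simpa only [zero_smul, add_zero] using mem_extChartAt_target (I := J1Model n) y))
  obtain ⟨δ, hδ, hsub⟩ := Metric.mem_nhds_iff.1 hmem
  rw [Real.ball_eq_Ioo, zero_sub, zero_add] at hsub
  have h0δ : (0 : ℝ) ∈ Ioo (-δ) δ := ⟨by linarith, hδ⟩
  have hsm := (contMDiffOn_extChartAt_symm (I := J1Model n) (n := ∞) y)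
  have h0 : χ.symm (χ y + (0 : ℝ) • w) = y := by
    rw [zero_smul, add_zero, hχ, extChartAt_to_inv]
  have hd : HasDerivAt (fun s : ℝ => χ y + s • w) w 0 := by
    simpa using ((hasDerivAt_id (0 : ℝ)).smul_const w).const_add (χ y)
  have hf : ContMDiffOn 𝓘(ℝ, ℝ) (J1Model n) ∞ (fun s : ℝ => χ.symm (χ y + s • w))
      (Ioo (-δ) δ) := by
    refine hsm.comp (t := χ.target) (f := fun s : ℝ => χ y + s • w) (ContMDiff.contMDiffOn ?_) hsub
    exact (contDiff_const.add (contDiff_id.smul contDiff_const)).contMDiff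
  refine ⟨δ, hδ, _, hf, tangentMap_eq_of_hasDerivAt_chart ((hf.mdifferentiableOn (by simp) 0
    h0δ).mdifferentiableAt (isOpen_Ioo.mem_nhds h0δ)) h0 (mem_extChartAt_source y) ?_⟩
  refine hd.congr_of_eventuallyEq ?_
  filter_upwards [isOpen_Ioo.mem_nhds h0δ] with s hs
  exact χ.right_inv (hsub hs)

lemma contactForm_velocity_congr {f g : ℝ → J1 n B} {s : ℝ} (h : g = f) :
    contactForm (g s) (mfderiv 𝓘(ℝ, ℝ) (J1Model n) g s (unitTangent s)) =
      contactForm (f s) (mfderiv 𝓘(ℝ, ℝ) (J1Model n) f s (unitTangent s)) := by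
  rw [h]

lemma IsContactHamiltonianFlow.contMDiff {H : ℝ → J1 n B → ℝ} {ψ : ℝ → J1 n B ≃ J1 n B}
    (hψ : IsContactHamiltonianFlow H ψ) {t : ℝ} (ht : t ∈ Icc (0 : ℝ) 1) :
    ContMDiff (J1Model n) (J1Model n) ∞ (ψ t) := by
  rw [← contMDiffOn_univ]
  exact hψ.smooth.comp ((contMDiff_const.prodMk contMDiff_id).contMDiffOn)
    fun y _ => ⟨ht, mem_univ y⟩

lemma IsContactHamiltonianFlow.contMDiff_symm {H : ℝ → J1 n B → ℝ} {ψ : ℝ → J1 n B ≃ J1 n B}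
    (hψ : IsContactHamiltonianFlow H ψ) {t : ℝ} (ht : t ∈ Icc (0 : ℝ) 1) :
    ContMDiff (J1Model n) (J1Model n) ∞ (ψ t).symm := by
  rw [← contMDiffOn_univ]
  exact hψ.smooth_symm.comp ((contMDiff_const.prodMk contMDiff_id).contMDiffOn)
    fun y _ => ⟨ht, mem_univ y⟩

/-- With f a curve of velocity v, the family ψ^t(f(s)) consists of trajectories, so λ(dψ^t v) solves
the linear equation with initial value λ(v). Only the kernel of λ matters below; the conformal
factor is never computed. -/
lemma IsContactHamiltonianFlow.contactForm_mfderiv_eq_zero_iff {H : ℝ → J1 n B → ℝ}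
    (hH : IsSmoothHamiltonian H) {ψ : ℝ → J1 n B ≃ J1 n B} (hψ : IsContactHamiltonianFlow H ψ)
    {t : ℝ} (ht : t ∈ Icc (0 : ℝ) 1) (y : J1 n B) (v : TangentSpace (J1Model n) y) :
    contactForm (ψ t y) (mfderiv (J1Model n) (J1Model n) (ψ t) y v) = 0 ↔ contactForm y v = 0 := by
  obtain ⟨δ, hδ, f, hf, hfv⟩ := exists_curve_velocity y v
  have h0δ : (0 : ℝ) ∈ Ioo (-δ) δ := ⟨by linarith, hδ⟩
  have hfd : MDifferentiableAt 𝓘(ℝ, ℝ) (J1Model n) f 0 :=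
    (hf.mdifferentiableOn (by simp) 0 h0δ).mdifferentiableAt (isOpen_Ioo.mem_nhds h0δ)
  have hf0 : f 0 = y := congrArg TotalSpace.proj hfv
  subst hf0
  have hv : mfderiv 𝓘(ℝ, ℝ) (J1Model n) f 0 (unitTangent 0) = v := by
    simpa [tangentMap] using! hfv
  subst hv
  have hc : ContMDiffOn (𝓘(ℝ, ℝ).prod 𝓘(ℝ, ℝ)) (J1Model n) ∞
      (fun x : ℝ × ℝ => ψ x.2 (f x.1)) (Ioo (-δ) δ ×ˢ Icc 0 1) :=
    hψ.smooth.comp (f := fun x : ℝ × ℝ => (x.2, f x.1))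
      (contMDiffOn_snd.prodMk (hf.comp contMDiffOn_fst fun x hx => hx.1))
      fun x hx => ⟨hx.2, mem_univ _⟩
  set a : ℝ → ℝ := fun t => contactForm (ψ t (f 0))
    (mfderiv 𝓘(ℝ, ℝ) (J1Model n) (fun s => ψ t (f s)) 0 (unitTangent 0)) with ha
  have key : ∀ t₁ ∈ Icc (0 : ℝ) 1, a t₁ = 0 → ∀ t ∈ Icc (0 : ℝ) 1, a t = 0 :=
    fun t₁ ht₁ h₁ t ht => contactForm_variation_eq_zero hH hδ
      (c := fun s t => ψ t (f s)) hc (fun s _ t ht => (hψ.deriv t ht (f s)).1)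
      (fun t ht => hψ.deriv t ht (f 0)) ht₁ h₁ ht
  have hvel : ∀ t ∈ Icc (0 : ℝ) 1, mfderiv 𝓘(ℝ, ℝ) (J1Model n) (fun s => ψ t (f s)) 0
      (unitTangent 0) = mfderiv (J1Model n) (J1Model n) (ψ t) (f 0)
        (mfderiv 𝓘(ℝ, ℝ) (J1Model n) f 0 (unitTangent 0)) := fun t ht =>
    mfderiv_comp_apply 0 ((hψ.contMDiff ht).mdifferentiable (by simp) _) hfd _
  have h00 : a 0 = contactForm (f 0) (mfderiv 𝓘(ℝ, ℝ) (J1Model n) f 0 (unitTangent 0)) := by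
    have : (fun s => ψ 0 (f s)) = f := funext fun s => hψ.zero _
    exact contactForm_velocity_congr (s := 0) (f := f) (g := fun s => ψ 0 (f s)) this
  have hat : a t = contactForm (ψ t (f 0)) (mfderiv (J1Model n) (J1Model n) (ψ t) (f 0)
      (mfderiv 𝓘(ℝ, ℝ) (J1Model n) f 0 (unitTangent 0))) :=
    congrArg (contactForm (ψ t (f 0))) (hvel t ht)
  rw [← hat, ← h00]
  have h0 : (0 : ℝ) ∈ Icc (0 : ℝ) 1 := ⟨le_rfl, zero_le_one⟩
  exact ⟨fun h => key t ht h 0 h0, fun h => key 0 h0 h t ht⟩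

end FlowPreservesContact

/-! ### Perturbing horizontal curves in the model space -/

section Perturbation

variable {n : ℕ}

lemma hasDerivWithinAt_integral_of_continuousOn {g : ℝ → ℝ} {a b : ℝ} (hab : a ≤ b)
    (hg : ContinuousOn g (Icc a b)) {t : ℝ} (ht : t ∈ Icc a b) :
    HasDerivWithinAt (fun r => ∫ x in a..r, g x) (g t) (Icc a b) t := by
  set r : ℝ → ℝ := IccExtend hab ((Icc a b).domRestrict g)
  have hr : Continuous r := (continuousOn_iff_continuous_domRestrict.1 hg).Icc_extend'
  have hrg : ∀ x ∈ Icc a b, g x = r x := fun x hx => (IccExtend_of_mem hab ((Icc a b).domRestrict g) hx).symm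
  rw [hrg t ht]
  have hi : ∀ x ∈ Icc a b, ∫ y in a..x, g y = ∫ y in a..x, r y := fun x hx => by
    refine intervalIntegral.integral_congr fun y hy => hrg y ?_
    rw [uIcc_of_le hx.1] at hy
    exact ⟨hy.1, hy.2.trans hx.2⟩
  exact (hr.integral_hasStrictDerivAt a t).hasDerivAt.hasDerivWithinAt.congr hi (hi t ht)

lemma contDiffOn_integral {g : ℝ → ℝ} {a b : ℝ} (hab : a < b) (hg : ContDiffOn ℝ ∞ g (Icc a b)) :
    ContDiffOn ℝ ∞ (fun r => ∫ x in a..r, g x) (Icc a b) := by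
  have h := fun t ht => hasDerivWithinAt_integral_of_continuousOn hab.le hg.continuousOn (t := t) ht
  rw [contDiffOn_infty_iff_derivWithin (uniqueDiffOn_Icc hab)]
  exact ⟨fun t ht => (h t ht).differentiableWithinAt, hg.congr fun t ht =>
    (h t ht).derivWithin (uniqueDiffOn_Icc hab t ht)⟩

/-- The first order change of `∫ p dq` along `x` in the direction `ξ`. -/
def firstVariation (x : ℝ → J1Space n) (ξ : ℝ → Model n × (Model n →L[ℝ] ℝ)) (a : ℝ) (t : ℝ) : ℝ :=
  ∫ r in a..t, ((ξ r).2 (derivWithin x (Icc a 1) r).1.1 + (x r).1.2 (deriv ξ r).1)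

/-- The second order term of `∫ p dq` in the direction `ξ`. -/
def secondVariation (ξ : ℝ → Model n × (Model n →L[ℝ] ℝ)) (a : ℝ) (t : ℝ) : ℝ :=
  ∫ r in a..t, (ξ r).2 (deriv ξ r).1

/-- The curve with `(q, p)`-part `x + s ξ`, lifted to be tangent to the contact distribution when
`x` is. -/
def perturbation (x : ℝ → J1Space n) (ξ : ℝ → Model n × (Model n →L[ℝ] ℝ)) (a : ℝ)
    (s t : ℝ) : J1Space n :=
  x t + (s • (ξ t, firstVariation x ξ a t) + s ^ 2 • ((0 : Model n × (Model n →L[ℝ] ℝ)),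
    secondVariation ξ a t))

variable {x : ℝ → J1Space n} {ξ : ℝ → Model n × (Model n →L[ℝ] ℝ)} {a : ℝ}

lemma contDiffOn_firstVariation_integrand (ha : a < 1) (hx : ContDiffOn ℝ ∞ x (Icc a 1))
    (hξ : ContDiff ℝ ∞ ξ) : ContDiffOn ℝ ∞
      (fun r => (ξ r).2 (derivWithin x (Icc a 1) r).1.1 + (x r).1.2 (deriv ξ r).1) (Icc a 1) := by
  have h1 := ((contDiffOn_infty_iff_derivWithin (uniqueDiffOn_Icc ha)).1 hx).2
  have h2 := (contDiff_infty_iff_deriv.1 hξ).2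
  exact (hξ.snd.contDiffOn.clm_apply h1.fst.fst).add (hx.fst.snd.clm_apply h2.fst.contDiffOn)

lemma contDiffOn_secondVariation_integrand (hξ : ContDiff ℝ ∞ ξ) : ContDiffOn ℝ ∞
      (fun r => (ξ r).2 (deriv ξ r).1) (Icc a 1) :=
  (hξ.snd.clm_apply (contDiff_infty_iff_deriv.1 hξ).2.fst).contDiffOn

lemma contDiffOn_perturbation (ha : a < 1) (hx : ContDiffOn ℝ ∞ x (Icc a 1))
    (hξ : ContDiff ℝ ∞ ξ) :
    ContDiffOn ℝ ∞ (fun y : ℝ × ℝ => perturbation x ξ a y.1 y.2) (univ ×ˢ Icc a 1) := by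
  have h1 := contDiffOn_integral ha (contDiffOn_firstVariation_integrand ha hx hξ)
  have h2 := contDiffOn_integral ha (contDiffOn_secondVariation_integrand (a := a) hξ)
  have hm : MapsTo Prod.snd ((univ : Set ℝ) ×ˢ Icc a 1) (Icc a 1) := fun y hy => hy.2
  exact (hx.comp contDiffOn_snd hm).add ((contDiffOn_fst.smul
    ((hξ.comp_contDiffOn contDiffOn_snd).prodMk (h1.comp contDiffOn_snd hm))).add
    ((contDiffOn_fst.pow 2).smul (contDiffOn_const.prodMk (h2.comp contDiffOn_snd hm))))

/-- Since ∫ p dq is quadratic in (q, p), its expansion along x + sξ stops at s². With both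
correction terms added to z, the curve is horizontal for every s, not merely to first order. -/
lemma stdForm_perturbation (ha : a < 1) (hx : ContDiffOn ℝ ∞ x (Icc a 1)) (hξ : ContDiff ℝ ∞ ξ)
    {t : ℝ} (ht : t ∈ Icc a 1) (h : stdForm (x t) (derivWithin x (Icc a 1) t) = 0) (s : ℝ) :
    stdForm (perturbation x ξ a s t) (derivWithin (perturbation x ξ a s) (Icc a 1) t) = 0 := by
  have hx' := (hx.differentiableOn (by simp) t ht).hasDerivWithinAt
  have hξ' := ((hξ.differentiable (by simp)) t).hasDerivAt.hasDerivWithinAt (s := Icc a 1)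
  have h1 := hasDerivWithinAt_integral_of_continuousOn ha.le
    (contDiffOn_firstVariation_integrand ha hx hξ).continuousOn ht
  have h2 := hasDerivWithinAt_integral_of_continuousOn ha.le
    (contDiffOn_secondVariation_integrand hξ).continuousOn ht
  have h3 := hx'.add (((hξ'.prodMk h1).const_smul s).add (((hasDerivWithinAt_const t (Icc a 1)
    (0 : Model n × (Model n →L[ℝ] ℝ))).prodMk h2).const_smul (s ^ 2)))
  have h4 := h3.derivWithin (uniqueDiffOn_Icc ha t ht)
  have h5 : derivWithin (perturbation x ξ a s) (Icc a 1) t = _ := h4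
  rw [h5]
  simp only [stdForm_apply] at h ⊢
  simp only [perturbation, Prod.snd_add, Prod.smul_snd, Prod.fst_add, Prod.smul_fst, smul_zero,
    add_zero, _root_.add_apply, map_add, _root_.smul_apply, map_smul,
    smul_eq_mul]
  linear_combination h

/-- The correcting integrals start at a, so nothing changes before ξ becomes active. This allows
gluing to the unperturbed path. -/
lemma perturbation_eq_self {t₂ : ℝ} (h : ∀ t < t₂, ξ t = 0) {s t : ℝ} (hat : a ≤ t)
    (ht : t < t₂) : perturbation x ξ a s t = x t := by
  have hd : ∀ r ∈ uIcc a t, deriv ξ r = 0 := fun r hr => by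
    rw [uIcc_of_le hat] at hr
    have : ξ =ᶠ[nhds r] fun _ => 0 := by
      filter_upwards [Iio_mem_nhds (hr.2.trans_lt ht)] with q hq using h q hq
    rw [this.deriv_eq, deriv_const]
  have h0 : ∀ r ∈ uIcc a t, ξ r = 0 := fun r hr => by
    rw [uIcc_of_le hat] at hr
    exact h r (hr.2.trans_lt ht)
  have h1 : firstVariation x ξ a t = 0 := by
    rw [firstVariation, intervalIntegral.integral_congr (g := fun _ => 0)]
    · simp
    · intro r hr
      simp [hd r hr, h0 r hr]
  have h2 : secondVariation ξ a t = 0 := by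
    rw [secondVariation, intervalIntegral.integral_congr (g := fun _ => 0)]
    · simp
    · intro r hr
      simp [hd r hr, h0 r hr]
  rw [perturbation, h1, h2, h t ht]
  simp

lemma perturbation_zero (t : ℝ) : perturbation x ξ a 0 t = x t := by
  simp [perturbation]

lemma hasDerivAt_perturbation (t : ℝ) :
    HasDerivAt (fun s => perturbation x ξ a s t) (ξ t, firstVariation x ξ a t) 0 := by
  have h := (((hasDerivAt_id (0 : ℝ)).smul_const (ξ t, firstVariation x ξ a t)).add
    (((hasDerivAt_id (0 : ℝ)).pow 2).smul_const ((0 : Model n × (Model n →L[ℝ] ℝ)),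
      secondVariation ξ a t))).const_add (x t)
  refine h.congr_deriv ?_
  simp

end Perturbation

/-! ### Horizontal families in the one-jet bundle -/

section HorizontalFamilies

variable {n : ℕ} {B : Type*} [TopologicalSpace B] [ChartedSpace (Model n) B]
  [IsManifold (𝓡 n) ∞ B]

lemma derivWithin_Icc_eq_of_lt {V : Type*} [NormedAddCommGroup V] [NormedSpace ℝ V] (f : ℝ → V)
    {a t : ℝ} (ha : 0 ≤ a) (hat : a < t) :
    derivWithin f (Icc 0 1) t = derivWithin f (Icc a 1) t := by
  refine derivWithin_congr_set ?_
  filter_upwards [Ioi_mem_nhds hat] with r hr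
  exact propext ⟨fun h => ⟨le_of_lt hr, h.2⟩, fun h => ⟨ha.trans h.1, h.2⟩⟩

/-- `u` is a smooth path on `[0,1]` which is tangent to the contact distribution. -/
def IsHorizontal (u : ℝ → J1 n B) : Prop :=
  ContMDiffOn 𝓘(ℝ, ℝ) (J1Model n) ∞ u (Icc 0 1) ∧ ∀ t ∈ Icc (0 : ℝ) 1, contactForm (u t)
    (mfderivWithin 𝓘(ℝ, ℝ) (J1Model n) u (Icc 0 1) t (unitTangent t)) = 0

lemma contactForm_velocity_congr_of_eventuallyEq {f g : ℝ → J1 n B} {t : ℝ}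
    (h : f =ᶠ[nhdsWithin t (Icc 0 1)] g) (ht : t ∈ Icc (0 : ℝ) 1) :
    contactForm (f t) (mfderivWithin 𝓘(ℝ, ℝ) (J1Model n) f (Icc 0 1) t (unitTangent t)) =
      contactForm (g t) (mfderivWithin 𝓘(ℝ, ℝ) (J1Model n) g (Icc 0 1) t (unitTangent t)) := by
  have h0 : f t = g t := h.eq_of_nhdsWithin ht
  have hc : ∀ (y : J1 n B) (hy : f t = y) , contactForm (f t) (mfderivWithin 𝓘(ℝ, ℝ) (J1Model n) f
      (Icc 0 1) t (unitTangent t)) = contactForm y (mfderivWithin 𝓘(ℝ, ℝ) (J1Model n) f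
      (Icc 0 1) t (unitTangent t)) := by
    rintro _ rfl
    rfl
  rw [hc _ h0, h.mfderivWithin_eq h0]
  rfl

/-- Perturbations of a horizontal path supported near its end point, which is contained in a
single chart. -/
lemma exists_horizontal_family {u : ℝ → J1 n B} (hu : IsHorizontal u) {a : ℝ} (ha0 : 0 ≤ a)
    (ha1 : a < 1) {y₀ : J1 n B} (hy : ∀ t ∈ Icc a 1, u t ∈ (extChartAt (J1Model n) y₀).source)
    {ξ : ℝ → Model n × (Model n →L[ℝ] ℝ)} (hξ : ContDiff ℝ ∞ ξ) {t₂ : ℝ} (ht₂ : a < t₂)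
    (hξ0 : ∀ t < t₂, ξ t = 0) :
    ∃ δ > (0 : ℝ), ∃ c : ℝ → ℝ → J1 n B,
      ContMDiffOn (𝓘(ℝ, ℝ).prod 𝓘(ℝ, ℝ)) (J1Model n) ∞ (fun x : ℝ × ℝ => c x.1 x.2)
        (Ioo (-δ) δ ×ˢ Icc 0 1) ∧
      (∀ s ∈ Ioo (-δ) δ, IsHorizontal (c s)) ∧
      (∀ t ∈ Icc (0 : ℝ) 1, c 0 t = u t) ∧ (∀ s, c s 0 = u 0) ∧
      HasDerivAt (fun s => extChartAt (J1Model n) y₀ (c s 1))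
        (ξ 1, firstVariation (fun t => extChartAt (J1Model n) y₀ (u t)) ξ a 1) 0 := by
  set χ := extChartAt (J1Model n) y₀ with hχ
  set x : ℝ → J1Space n := fun t => χ (u t) with hxdef
  have hsub : Icc a 1 ⊆ Icc (0 : ℝ) 1 := Icc_subset_Icc_left ha0
  have hx : ContDiffOn ℝ ∞ x (Icc a 1) := fun t ht => by
    rw [← contMDiffWithinAt_iff_contDiffWithinAt]
    exact (contMDiffAt_chart (hy t ht)).comp_contMDiffWithinAt t ((hu.1 t (hsub ht)).mono hsub)
  have hP := contDiffOn_perturbation ha1 hx hξ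
  -- A gluing time before `t₂`: the original path and the chart perturbation agree on the overlap t₃
  -- < t < t₂, so smoothness and horizontality can be checked separately on t < t₂ and t > t₃.
  obtain ⟨t₃, ht₃, ht₃'⟩ := exists_between (lt_min ht₂ ha1)
  have ht₃2 : t₃ < t₂ := ht₃'.trans_le (min_le_left _ _)
  have ht₃1 : t₃ < 1 := ht₃'.trans_le (min_le_right _ _)
  -- Compactness of [a,1] makes δ uniform in t. The repeated membership hypothesis turns a statement
  -- on full neighbourhoods of (0, t) into one within the strip, where continuity is known.
  have htarget : ∀ᶠ s in nhds (0 : ℝ), ∀ t ∈ Icc a 1, t ∈ Icc a 1 → perturbation x ξ a s t ∈ χ.target := by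
    refine isCompact_Icc.eventually_forall_of_forall_eventually fun t ht => ?_
    have h1 := (hP (0, t) ⟨mem_univ _, ht⟩).continuousWithinAt.preimage_mem_nhdsWithin
      ((isOpen_extChartAt_target (I := J1Model n) y₀).mem_nhds (by
        rw [perturbation_zero]; exact χ.map_source (hy t ht)))
    filter_upwards [eventually_nhdsWithin_iff.1 h1] with z hz hzt using hz ⟨mem_univ _, hzt⟩
  obtain ⟨δ, hδ, hball⟩ := Metric.mem_nhds_iff.1 htarget
  rw [Real.ball_eq_Ioo, zero_sub, zero_add] at hball
  have h0δ : (0 : ℝ) ∈ Ioo (-δ) δ := ⟨by linarith, hδ⟩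
  have hT : ∀ s ∈ Ioo (-δ) δ, ∀ t ∈ Icc a 1, perturbation x ξ a s t ∈ χ.target :=
    fun s hs t ht => hball hs t ht ht
  set c : ℝ → ℝ → J1 n B := fun s t => if t < t₃ then u t else χ.symm (perturbation x ξ a s t)
    with hcdef
  have hcu : ∀ s, ∀ t ∈ Icc (0 : ℝ) 1, t < t₂ → c s t = u t := fun s t ht ht2 => by
    by_cases h : t < t₃
    · simp [hcdef, h]
    · have hat : a ≤ t := ht₃.le.trans (not_lt.1 h)
      simp only [hcdef, h, if_false]
      rw [perturbation_eq_self hξ0 hat ht2]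
      exact χ.left_inv (hy t ⟨hat, ht.2⟩)
  have hcP : ∀ s t, t₃ < t → c s t = χ.symm (perturbation x ξ a s t) := fun s t ht => by
    simp [hcdef, not_lt.2 ht.le]
  have hsm : ContMDiffOn (𝓘(ℝ, ℝ).prod 𝓘(ℝ, ℝ)) (J1Model n) ∞ (fun x : ℝ × ℝ => c x.1 x.2)
        (Ioo (-δ) δ ×ˢ Icc 0 1) := by
    rintro ⟨s, t⟩ ⟨hs, ht⟩
    rcases lt_or_ge t t₂ with h | h
    · refine ((hu.1.comp (s := Ioo (-δ) δ ×ˢ Icc 0 1) contMDiffOn_snd fun z hz => hz.2) (s, t) ⟨hs, ht⟩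
        ).congr_of_eventuallyEq ?_ (hcu s t ht h)
      filter_upwards [self_mem_nhdsWithin, mem_nhdsWithin_of_mem_nhds
        (continuousAt_snd.preimage_mem_nhds (Iio_mem_nhds h))] with z hz hz2
      exact hcu z.1 z.2 hz.2 hz2
    · have h3 : t₃ < t := ht₃2.trans_le h
      have hat : a < t := ht₃.trans h3
      have hPm : ContMDiffWithinAt (𝓘(ℝ, ℝ).prod 𝓘(ℝ, ℝ)) 𝓘(ℝ, J1Space n) ∞
          (fun y : ℝ × ℝ => perturbation x ξ a y.1 y.2) (univ ×ˢ Icc a 1) (s, t) :=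
        contMDiffWithinAt_prod_self_iff.2 (hP (s, t) ⟨mem_univ _, hat.le, ht.2⟩)
      have hs1 := ((contMDiffOn_extChartAt_symm (I := J1Model n) (n := ∞) y₀).contMDiffAt
        ((isOpen_extChartAt_target (I := J1Model n) y₀).mem_nhds
          (hT s hs t ⟨hat.le, ht.2⟩))).comp_contMDiffWithinAt (s, t) hPm
      have hs2 := hs1.mono_of_mem_nhdsWithin (t := Ioo (-δ) δ ×ˢ Icc 0 1) (by
        filter_upwards [self_mem_nhdsWithin, mem_nhdsWithin_of_mem_nhds
          (continuousAt_snd.preimage_mem_nhds (Ioi_mem_nhds hat))] with z hz hz2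
        exact ⟨mem_univ _, le_of_lt hz2, hz.2.2⟩)
      refine hs2.congr_of_eventuallyEq ?_ (hcP s t h3)
      filter_upwards [mem_nhdsWithin_of_mem_nhds
        (continuousAt_snd.preimage_mem_nhds (Ioi_mem_nhds h3))] with z hz
      exact hcP z.1 z.2 hz
  have hhor : ∀ s ∈ Ioo (-δ) δ, IsHorizontal (c s) := fun s hs => by
    refine ⟨contMDiffOn_slice_snd hsm hs, fun t ht => ?_⟩
    rcases lt_or_ge t t₂ with h | h
    · rw [contactForm_velocity_congr_of_eventuallyEq (g := u) _ ht, hu.2 t ht]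
      filter_upwards [self_mem_nhdsWithin, mem_nhdsWithin_of_mem_nhds (Iio_mem_nhds h)] with r hr hr2
      exact hcu s r hr hr2
    · have h3 : t₃ < t := ht₃2.trans_le h
      have hat : a < t := ht₃.trans h3
      have hmem := hT s hs t ⟨hat.le, ht.2⟩
      have hcs : c s t ∈ χ.source := by
        rw [hcP s t h3]
        exact χ.map_target hmem
      have hev : (fun r => χ (c s r)) =ᶠ[nhdsWithin t (Icc 0 1)] perturbation x ξ a s := by
        filter_upwards [self_mem_nhdsWithin, mem_nhdsWithin_of_mem_nhds (Ioi_mem_nhds h3)]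
          with r hr hr3
        rw [hcP s r hr3]
        exact χ.right_inv (hT s hs r ⟨(ht₃.trans hr3).le, hr.2⟩)
      have hx0 : stdForm (x t) (derivWithin x (Icc a 1) t) = 0 := by
        rw [← hu.2 t ht, contactForm_velocity (hu.1.mdifferentiableOn (by simp) t ht)
          (uniqueDiffOn_Icc zero_lt_one t ht) (hy t ⟨hat.le, ht.2⟩),
          derivWithin_Icc_eq_of_lt _ ha0 hat]
      have hder : derivWithin (fun r => χ (c s r)) (Icc 0 1) t =
          derivWithin (perturbation x ξ a s) (Icc a 1) t := by
        rw [hev.derivWithin_eq (hev.eq_of_nhdsWithin ht), derivWithin_Icc_eq_of_lt _ ha0 hat]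
      rw [contactForm_velocity ((contMDiffOn_slice_snd hsm hs).mdifferentiableOn (by simp) t ht)
        (uniqueDiffOn_Icc zero_lt_one t ht) hcs, hder]
      have hχc : χ (c s t) = perturbation x ξ a s t := hev.eq_of_nhdsWithin ht
      rw [hχc]
      exact stdForm_perturbation ha1 hx hξ ⟨hat.le, ht.2⟩ hx0 s
  refine ⟨δ, hδ, c, hsm, hhor, fun t ht => ?_, fun s => ?_, ?_⟩
  · rcases lt_or_ge t t₂ with h | h
    · exact hcu 0 t ht h
    · have h3 : t₃ < t := ht₃2.trans_le h
      rw [hcP 0 t h3, perturbation_zero]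
      exact χ.left_inv (hy t ⟨(ht₃.trans h3).le, ht.2⟩)
  · exact hcu s 0 ⟨le_rfl, zero_le_one⟩ (ha0.trans_lt ht₂)
  · refine (hasDerivAt_perturbation (x := x) 1).congr_of_eventuallyEq ?_
    filter_upwards [isOpen_Ioo.mem_nhds h0δ] with s hs
    rw [hcP s 1 ht₃1]
    exact χ.right_inv (hT s hs 1 ⟨ha1.le, le_rfl⟩)

end HorizontalFamilies

/-! ### Pulling the path space back by the flow -/

section PathSpace

variable {n : ℕ} {B : Type*} [TopologicalSpace B] [ChartedSpace (Model n) B]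
  [IsManifold (𝓡 n) ∞ B] {H : ℝ → J1 n B → ℝ} {ψ : ℝ → J1 n B ≃ J1 n B}

lemma IsContactHamiltonianFlow.contMDiffOn_comp (hψ : IsContactHamiltonianFlow H ψ) {u : ℝ → J1 n B}
    (hu : ContMDiffOn 𝓘(ℝ, ℝ) (J1Model n) ∞ u (Icc 0 1)) :
    ContMDiffOn 𝓘(ℝ, ℝ) (J1Model n) ∞ (fun t => ψ t (u t)) (Icc 0 1) :=
  hψ.smooth.comp (f := fun t => (t, u t)) (contMDiffOn_id.prodMk hu) fun _ ht => ⟨ht, mem_univ _⟩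

lemma IsContactHamiltonianFlow.contMDiffOn_symm_comp (hψ : IsContactHamiltonianFlow H ψ)
    {u : ℝ → J1 n B} (hu : ContMDiffOn 𝓘(ℝ, ℝ) (J1Model n) ∞ u (Icc 0 1)) :
    ContMDiffOn 𝓘(ℝ, ℝ) (J1Model n) ∞ (fun t => (ψ t).symm (u t)) (Icc 0 1) :=
  hψ.smooth_symm.comp (f := fun t => (t, u t)) (contMDiffOn_id.prodMk hu)
    fun _ ht => ⟨ht, mem_univ _⟩

/-- Chain rule on the diagonal of (a, b) ↦ ψ^a(u(b)): the first slot moves along the contact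
Hamiltonian field and contributes -H, the second contributes λ(dψ^t u'). -/
lemma IsContactHamiltonianFlow.contactForm_velocity_comp (hψ : IsContactHamiltonianFlow H ψ)
    {u : ℝ → J1 n B} (hu : ContMDiffOn 𝓘(ℝ, ℝ) (J1Model n) ∞ u (Icc 0 1)) {t : ℝ}
    (ht : t ∈ Icc (0 : ℝ) 1) :
    contactForm (ψ t (u t)) (mfderivWithin 𝓘(ℝ, ℝ) (J1Model n) (fun r => ψ r (u r)) (Icc 0 1) t
      (unitTangent t)) = -H t (ψ t (u t)) +
    contactForm (ψ t (u t)) (mfderiv (J1Model n) (J1Model n) (ψ t) (u t)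
      (mfderivWithin 𝓘(ℝ, ℝ) (J1Model n) u (Icc 0 1) t (unitTangent t))) := by
  have hU : UniqueDiffWithinAt ℝ (Icc (0 : ℝ) 1) t := uniqueDiffOn_Icc zero_lt_one t ht
  set c : ℝ → ℝ → J1 n B := fun a b => ψ a (u b) with hc
  have hcs : ContMDiffOn (𝓘(ℝ, ℝ).prod 𝓘(ℝ, ℝ)) (J1Model n) ∞ (fun x : ℝ × ℝ => c x.1 x.2)
      (Icc 0 1 ×ˢ Icc 0 1) :=
    hψ.smooth.comp (f := fun x : ℝ × ℝ => (x.1, u x.2))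
      (contMDiffOn_fst.prodMk (hu.comp contMDiffOn_snd fun x hx => hx.2))
      fun x hx => ⟨hx.1, mem_univ _⟩
  have hy : c t t ∈ (extChartAt (J1Model n) (c t t)).source := mem_extChartAt_source _
  have hK := (contDiffWithinAt_chart_comp hcs ht ht hy).differentiableWithinAt (by simp)
  have h1 := (hasDerivWithinAt_slice_fst hK ht).derivWithin hU
  have h2 := (hasDerivWithinAt_slice_snd hK ht).derivWithin hU
  have h3 := (hK.hasFDerivWithinAt.comp_hasDerivWithinAt (f := fun r : ℝ => (r, r)) t
    ((hasDerivAt_id t).prodMk (hasDerivAt_id t)).hasDerivWithinAt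
    (fun r hr => ⟨hr, hr⟩)).derivWithin hU
  have hadd : ((1 : ℝ), (1 : ℝ)) = (1, 0) + (0, 1) := by simp
  rw [hadd, map_add, ← h1, ← h2] at h3
  have e1 := contactForm_velocity (y₀ := c t t) (f := fun r => c r t) (S := Icc 0 1) (t := t)
    ((contMDiffOn_slice_fst hcs ht).mdifferentiableOn (by simp) t ht) hU hy
  have e2 := contactForm_velocity (y₀ := c t t) (f := fun r => c t r) (S := Icc 0 1) (t := t)
    ((contMDiffOn_slice_snd hcs ht).mdifferentiableOn (by simp) t ht) hU hy
  have e3 := contactForm_velocity (y₀ := c t t) (f := fun r => c r r) (S := Icc 0 1) (t := t)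
    ((hψ.contMDiffOn_comp hu).mdifferentiableOn (by simp) t ht) hU hy
  have e4 : mfderivWithin 𝓘(ℝ, ℝ) (J1Model n) (fun r => c t r) (Icc 0 1) t (unitTangent t) =
      mfderiv (J1Model n) (J1Model n) (ψ t) (u t)
      (mfderivWithin 𝓘(ℝ, ℝ) (J1Model n) u (Icc 0 1) t (unitTangent t)) :=
    DFunLike.congr_fun (mfderiv_comp_mfderivWithin t
      ((hψ.contMDiff ht).mdifferentiable (by simp) (u t)) (hu.mdifferentiableOn (by simp) t ht)
      hU.uniqueMDiffWithinAt) (unitTangent t)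
  have e5 := (hψ.deriv t ht (u t)).1
  refine e3.trans ?_
  refine (congrArg _ h3).trans ?_
  rw [map_add]
  refine congrArg₂ _ (e1.symm.trans e5) (e2.symm.trans ?_)
  exact congrArg (contactForm (c t t)) e4

/-- Reduces the constraint to the case H = 0: by the previous identity λ(∂ₜ) + H equals λ(dψ^t u'),
which vanishes exactly when λ(u') does. -/
lemma IsContactHamiltonianFlow.isHorizontal_iff (hH : IsSmoothHamiltonian H)
    (hψ : IsContactHamiltonianFlow H ψ) {u : ℝ → J1 n B}
    (hu : ContMDiffOn 𝓘(ℝ, ℝ) (J1Model n) ∞ u (Icc 0 1)) :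
    IsHorizontal u ↔ ∀ t ∈ Icc (0 : ℝ) 1, contactForm (ψ t (u t))
      (mfderivWithin 𝓘(ℝ, ℝ) (J1Model n) (fun r => ψ r (u r)) (Icc 0 1) t (unitTangent t)) +
        H t (ψ t (u t)) = 0 := by
  rw [IsHorizontal, and_iff_right hu]
  refine forall₂_congr fun t ht => ?_
  rw [← hψ.contactForm_mfderiv_eq_zero_iff hH ht, hψ.contactForm_velocity_comp hu ht]
  constructor <;> intro h <;> linarith

lemma ext_apply_of_mem (γ : C(unitInterval, J1 n B)) {t : ℝ} (ht : t ∈ Icc (0 : ℝ) 1) :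
    ext γ t = γ ⟨t, ht⟩ := IccExtend_of_mem _ _ ht

lemma ext_zero (γ : C(unitInterval, J1 n B)) : ext γ 0 = γ 0 := ext_apply_of_mem γ (by simp)

lemma ext_one (γ : C(unitInterval, J1 n B)) : ext γ 1 = γ 1 := ext_apply_of_mem γ (by simp)

/-- The pullback of a path by the flow. -/
def pullback (ψ : ℝ → J1 n B ≃ J1 n B) (γ : CarnotPath H) (t : ℝ) : J1 n B :=
  (ψ t).symm (ext γ.1 t)

lemma apply_pullback (γ : CarnotPath H) (t : ℝ) : ψ t (pullback ψ γ t) = ext γ.1 t :=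
  (ψ t).apply_symm_apply _

lemma isHorizontal_pullback (hH : IsSmoothHamiltonian H) (hψ : IsContactHamiltonianFlow H ψ)
    (γ : CarnotPath H) : IsHorizontal (pullback ψ γ) := by
  refine (hψ.isHorizontal_iff hH (hψ.contMDiffOn_symm_comp γ.2.1)).2 fun t ht => ?_
  exact (congrArg₂ (· + ·) (contactForm_velocity_congr_of_eventuallyEq (g := ext γ.1)
    (Filter.Eventually.of_forall fun r => apply_pullback γ r) ht)
    (congrArg (H t) (apply_pullback γ t))).trans (γ.2.2.1 t ht)

lemma pullback_zero (hψ : IsContactHamiltonianFlow H ψ) (γ : CarnotPath H) :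
    pullback ψ γ 0 = γ.1 0 := by
  rw [pullback, Equiv.symm_apply_eq, hψ.zero, ext_zero]

lemma exists_carnotPath (hH : IsSmoothHamiltonian H) (hψ : IsContactHamiltonianFlow H ψ)
    {u : ℝ → J1 n B} (hu : IsHorizontal u) (h0 : u 0 ∈ zeroSection n B) :
    ∃ γ : CarnotPath H, ∀ t ∈ Icc (0 : ℝ) 1, ext γ.1 t = ψ t (u t) := by
  have hs := hψ.contMDiffOn_comp hu.1
  set γ : C(unitInterval, J1 n B) := ⟨fun t => ψ t (u t),
    continuousOn_iff_continuous_domRestrict.1 hs.continuousOn⟩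
  have he : ∀ t ∈ Icc (0 : ℝ) 1, ext γ t = ψ t (u t) := fun t ht => ext_apply_of_mem γ ht
  refine ⟨⟨γ, hs.congr he, fun t ht => ?_, ?_⟩, he⟩
  · rw [← (hψ.isHorizontal_iff hH hu.1).1 hu t ht, contactDefect, velocity,
      contactForm_velocity_congr_of_eventuallyEq (Filter.eventuallyEq_of_mem self_mem_nhdsWithin he)
        ht, he t ht]
  · rw [← ext_zero, he 0 (by simp), hψ.zero]
    exact h0

/-- The constraint kills the integrand, whatever value the conformal exponent takes. -/
lemma actionCC_eq (γ : CarnotPath H) : actionCC ψ γ = zCoord (evalOne γ) := by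
  have h : perturbedAction H ψ γ.1 = 0 := by
    rw [perturbedAction, intervalIntegral.integral_congr (g := fun _ => 0)]
    · simp
    · intro t ht
      rw [uIcc_of_le zero_le_one] at ht
      simp [γ.2.2.1 t ht]
  rw [actionCC, effectiveAction, h, neg_zero, zero_add]
  rfl

lemma IsSmoothFamily.mdifferentiableAt_evalOne {c : ℝ → CarnotPath H} (hc : IsSmoothFamily c) :
    MDifferentiableAt 𝓘(ℝ, ℝ) (J1Model n) (fun s => evalOne (c s)) 0 := by
  obtain ⟨δ, hδ, hc⟩ := hc
  have h0 : (0 : ℝ) ∈ Ioo (-δ) δ := ⟨by linarith, hδ⟩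
  have h := ((contMDiffOn_slice_fst (c := fun s t => ext (c s).1 t) hc (t := 1)
    (by simp)).mdifferentiableOn (by simp) 0 h0).mdifferentiableAt (isOpen_Ioo.mem_nhds h0)
  have e : (fun s => evalOne (c s)) = fun s => ext (c s).1 1 := funext fun s => (ext_one _).symm
  rw [e]
  exact h

lemma representsOver_of_tangentMap_evalOne {c : ℝ → CarnotPath H} {γ : CarnotPath H}
    (hc : IsSmoothFamily c) (h0 : c 0 = γ) {η : TangentSpace (J1Model n) (evalOne γ)}
    (hη : tangentMap 𝓘(ℝ, ℝ) (J1Model n) (fun s => evalOne (c s)) ⟨0, unitTangent 0⟩ =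
      (⟨evalOne γ, η⟩ : TangentBundle (J1Model n) (J1 n B))) :
    RepresentsOver c γ (mfderiv (J1Model n) (𝓡 n) toBase (evalOne γ) η) := by
  refine ⟨hc, h0, ?_⟩
  have h := tangentMap_comp_at (I := 𝓘(ℝ, ℝ)) (I' := J1Model n) (I'' := 𝓡 n)
    (⟨0, unitTangent 0⟩ : TangentBundle 𝓘(ℝ, ℝ) ℝ)
    (mdifferentiable_toBase (n := n) (B := B) _) hc.mdifferentiableAt_evalOne
  rw [hη] at h
  exact h

lemma hasDerivAt_actionCC {c : ℝ → CarnotPath H} {γ : CarnotPath H}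
    (hc : IsSmoothFamily c) (h0 : c 0 = γ) {η : TangentSpace (J1Model n) (evalOne γ)}
    (hη : tangentMap 𝓘(ℝ, ℝ) (J1Model n) (fun s => evalOne (c s)) ⟨0, unitTangent 0⟩ =
      (⟨evalOne γ, η⟩ : TangentBundle (J1Model n) (J1 n B))) :
    HasDerivAt (fun s => actionCC ψ (c s)) (mvfderiv (J1Model n) zCoord (evalOne γ) η) 0 := by
  subst h0
  have hm := hc.mdifferentiableAt_evalOne
  have hη' : mfderiv 𝓘(ℝ, ℝ) (J1Model n) (fun s => evalOne (c s)) 0 (unitTangent 0) = η := by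
    simpa [tangentMap] using! hη
  subst hη'
  have hz := mdifferentiable_zCoord (n := n) (B := B) (evalOne (c 0))
  have h1 := mfderiv_comp_apply 0 (I' := J1Model n) hz hm (unitTangent 0)
  have hd : DifferentiableAt ℝ (fun s => zCoord (evalOne (c s))) 0 :=
    (MDifferentiableAt.comp 0 hz hm).differentiableAt
  rw [mfderiv_eq_fderiv] at h1
  simp only [actionCC_eq]
  exact hd.hasDerivAt.congr_deriv h1

end PathSpace

/-! ### End-point variations and the first variation at critical paths -/

section CriticalPaths

variable {n : ℕ} {B : Type*} [TopologicalSpace B] [ChartedSpace (Model n) B]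
  [IsManifold (𝓡 n) ∞ B] {H : ℝ → J1 n B → ℝ} {ψ : ℝ → J1 n B ≃ J1 n B}

lemma tangentMap_congr_of_eventuallyEq {f g : ℝ → J1 n B} (h : f =ᶠ[nhds 0] g) :
    tangentMap 𝓘(ℝ, ℝ) (J1Model n) f ⟨0, unitTangent 0⟩ =
      tangentMap 𝓘(ℝ, ℝ) (J1Model n) g ⟨0, unitTangent 0⟩ :=
  TotalSpace.ext h.eq_of_nhds (heq_of_eq (DFunLike.congr_fun h.mfderiv_eq (unitTangent 0)))

lemma exists_mk_eq_of_proj_eq {p : TangentBundle (J1Model n) (J1 n B)} {y : J1 n B}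
    (h : p.proj = y) :
    ∃ w : TangentSpace (J1Model n) y, (⟨y, w⟩ : TangentBundle (J1Model n) (J1 n B)) = p := by
  subst h
  exact ⟨p.2, rfl⟩

/-- Infinitesimal perturbations of the pulled back path are realized by families in the path
space. -/
lemma exists_smoothFamily (hH : IsSmoothHamiltonian H) (hψ : IsContactHamiltonianFlow H ψ)
    (γ : CarnotPath H) {a : ℝ} (ha0 : 0 ≤ a) (ha1 : a < 1) {y₀ : J1 n B}
    (hy : ∀ t ∈ Icc a 1, pullback ψ γ t ∈ (extChartAt (J1Model n) y₀).source)
    {ξ : ℝ → Model n × (Model n →L[ℝ] ℝ)} (hξ : ContDiff ℝ ∞ ξ) {t₂ : ℝ} (ht₂ : a < t₂)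
    (hξ0 : ∀ t < t₂, ξ t = 0) (w : TangentSpace (J1Model n) (pullback ψ γ 1))
    (hw : mvfderiv (J1Model n) (extChartAt (J1Model n) y₀) (pullback ψ γ 1) w =
      (ξ 1, firstVariation (fun t => extChartAt (J1Model n) y₀ (pullback ψ γ t)) ξ a 1)) :
    ∃ c : ℝ → CarnotPath H, IsSmoothFamily c ∧ c 0 = γ ∧
      tangentMap 𝓘(ℝ, ℝ) (J1Model n) (fun s => evalOne (c s)) ⟨0, unitTangent 0⟩ =
        tangentMap (J1Model n) (J1Model n) (ψ 1) ⟨pullback ψ γ 1, w⟩ := by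
  have h01 : (0 : ℝ) ∈ Icc (0 : ℝ) 1 := by simp
  have h11 : (1 : ℝ) ∈ Icc (0 : ℝ) 1 := by simp
  obtain ⟨δ, hδ, u, hu, hhor, hu0, hus, hud⟩ := exists_horizontal_family
    (isHorizontal_pullback hH hψ γ) ha0 ha1 hy hξ ht₂ hξ0
  have h0δ : (0 : ℝ) ∈ Ioo (-δ) δ := ⟨by linarith, hδ⟩
  -- A family must be given for all real s; outside (-δ, δ) it takes the irrelevant value γ.
  have hex : ∀ s, ∃ γ' : CarnotPath H, s ∈ Ioo (-δ) δ → ∀ t ∈ Icc (0 : ℝ) 1,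
      ext γ'.1 t = ψ t (u s t) := fun s => by
    by_cases hs : s ∈ Ioo (-δ) δ
    · obtain ⟨γ', hγ'⟩ := exists_carnotPath hH hψ (hhor s hs) (by
        rw [hus s, pullback_zero hψ]; exact γ.2.2.2)
      exact ⟨γ', fun _ => hγ'⟩
    · exact ⟨γ, fun h => absurd h hs⟩
  choose c hc using hex
  have hc1 : ∀ s ∈ Ioo (-δ) δ, evalOne (c s) = ψ 1 (u s 1) := fun s hs => by
    rw [← hc s hs 1 h11, ext_one]
    rfl
  have hum : MDifferentiableAt 𝓘(ℝ, ℝ) (J1Model n) (fun s => u s 1) 0 :=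
    ((contMDiffOn_slice_fst hu h11).mdifferentiableOn (by simp) 0 h0δ).mdifferentiableAt
      (isOpen_Ioo.mem_nhds h0δ)
  refine ⟨c, ⟨δ, hδ, ?_⟩, ?_, ?_⟩
  · have := hψ.smooth.comp (f := fun x : ℝ × ℝ => (x.2, u x.1 x.2)) (contMDiffOn_snd.prodMk hu)
      fun x hx => ⟨hx.2, mem_univ _⟩
    exact this.congr fun x hx => hc x.1 hx.1 x.2 hx.2
  · refine Subtype.ext (ContinuousMap.ext fun t => ?_)
    have h := hc 0 h0δ t t.2
    rw [hu0 t t.2, apply_pullback, ext_apply_of_mem _ t.2, ext_apply_of_mem _ t.2] at h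
    exact h
  · have hT := tangentMap_eq_of_hasDerivAt_chart hum (hu0 1 h11) (hy 1 ⟨ha1.le, le_rfl⟩)
      (v := w) (by rw [hw]; exact hud)
    rw [← hT]
    have hcomp := tangentMap_comp_at (I := 𝓘(ℝ, ℝ)) (I' := J1Model n) (I'' := J1Model n)
      (⟨0, unitTangent 0⟩ : TangentBundle 𝓘(ℝ, ℝ) ℝ) (f := fun s => u s 1)
      ((hψ.contMDiff h11).mdifferentiable (by simp) (u 0 1)) hum
    rw [← hcomp]
    have hev : (fun s => evalOne (c s)) =ᶠ[nhds 0] (ψ 1) ∘ fun s => u s 1 := by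
      filter_upwards [isOpen_Ioo.mem_nhds h0δ] with s hs using hc1 s hs
    exact tangentMap_congr_of_eventuallyEq hev

/-- Take w to be the image of η under the differential of (ψ^1)⁻¹. The equation lives in the total
space of the tangent bundle because the two base points are equal only propositionally. -/
lemma exists_tangentMap_eq (hψ : IsContactHamiltonianFlow H ψ)
    (γ : CarnotPath H) (η : TangentSpace (J1Model n) (evalOne γ)) :
    ∃ w : TangentSpace (J1Model n) (pullback ψ γ 1),
      tangentMap (J1Model n) (J1Model n) (ψ 1) ⟨pullback ψ γ 1, w⟩ =
        (⟨evalOne γ, η⟩ : TangentBundle (J1Model n) (J1 n B)) := by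
  have h11 : (1 : ℝ) ∈ Icc (0 : ℝ) 1 := by simp
  set q : TangentBundle (J1Model n) (J1 n B) := ⟨evalOne γ, η⟩
  have hp : (tangentMap (J1Model n) (J1Model n) (ψ 1).symm q).proj = pullback ψ γ 1 := by
    rw [pullback, ext_one]
    rfl
  obtain ⟨w, hw⟩ := exists_mk_eq_of_proj_eq hp
  refine ⟨w, ?_⟩
  rw [hw, ← tangentMap_comp_at q ((hψ.contMDiff h11).mdifferentiable (by simp) _)
    ((hψ.contMDiff_symm h11).mdifferentiable (by simp) _)]
  have : (ψ 1) ∘ (ψ 1).symm = id := funext fun y => (ψ 1).apply_symm_apply y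
  rw [this, tangentMap_id]
  rfl

lemma mvfderiv_zCoord_reeb (y : J1 n B) : mvfderiv (J1Model n) zCoord y (reeb y) = 1 := by
  rw [mvfderiv_reeb (mdifferentiable_zCoord y)]
  simp [zCoord]

lemma mfderiv_toBase_reeb (y : J1 n B) :
    mfderiv (J1Model n) (𝓡 n) toBase y (reeb y) = 0 := by
  have hg : MDifferentiableAt 𝓘(ℝ, ℝ) (J1Model n) (fun s : ℝ => ((y.1, s) : J1 n B)) y.2 :=
    mdifferentiableAt_const.prodMk mdifferentiableAt_id
  have h1 := mfderiv_comp_apply y.2 (I' := J1Model n) (f := fun s : ℝ => ((y.1, s) : J1 n B))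
    (g := toBase) (mdifferentiable_toBase _) hg (unitTangent y.2)
  have h2 : toBase ∘ (fun s : ℝ => ((y.1, s) : J1 n B)) = fun _ => toBase y := rfl
  rw [h2, mfderiv_const] at h1
  exact h1.symm

lemma firstVariation_add_smul {x : ℝ → J1Space n} {ξ ζ : ℝ → Model n × (Model n →L[ℝ] ℝ)} {a : ℝ}
    (ha : a < 1) (hx : ContDiffOn ℝ ∞ x (Icc a 1)) (hξ : ContDiff ℝ ∞ ξ) (hζ : ContDiff ℝ ∞ ζ)
    (m : ℝ) : firstVariation x (fun t => ξ t + m • ζ t) a 1 =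
      firstVariation x ξ a 1 + m * firstVariation x ζ a 1 := by
  have h1 := (contDiffOn_firstVariation_integrand ha hx hξ).continuousOn.intervalIntegrable_of_Icc
    (μ := MeasureTheory.volume) ha.le
  have h2 := (contDiffOn_firstVariation_integrand ha hx hζ).continuousOn.intervalIntegrable_of_Icc
    (μ := MeasureTheory.volume) ha.le
  rw [firstVariation, firstVariation, firstVariation, ← intervalIntegral.integral_const_mul,
    ← intervalIntegral.integral_add h1 (h2.const_mul m)]
  refine intervalIntegral.integral_congr fun t _ => ?_
  have hd : deriv (fun t => ξ t + m • ζ t) t = deriv ξ t + m • deriv ζ t :=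
    ((hξ.differentiable (by simp) t).hasDerivAt.add
      ((hζ.differentiable (by simp) t).hasDerivAt.const_smul m)).deriv
  simp only [hd, Prod.snd_add, Prod.smul_snd, Prod.fst_add, Prod.smul_fst, _root_.add_apply,
    map_add, _root_.smul_apply, map_smul, smul_eq_mul]
  ring

/-- At a vertical critical point the first variation vanishes in all directions supported away from
the end points. -/
lemma firstVariation_eq_zero_of_mem_verticalCriticalSet (hH : IsSmoothHamiltonian H)
    (hψ : IsContactHamiltonianFlow H ψ) {γ : CarnotPath H} (hγ : γ ∈ verticalCriticalSet H ψ)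
    {a : ℝ} (ha0 : 0 ≤ a) (ha1 : a < 1) {y₀ : J1 n B}
    (hy : ∀ t ∈ Icc a 1, pullback ψ γ t ∈ (extChartAt (J1Model n) y₀).source)
    {ξ : ℝ → Model n × (Model n →L[ℝ] ℝ)} (hξ : ContDiff ℝ ∞ ξ) {t₂ : ℝ} (ht₂ : a < t₂)
    (hξ0 : ∀ t < t₂, ξ t = 0) (hξ1 : ξ 1 = 0) :
    firstVariation (fun t => extChartAt (J1Model n) y₀ (pullback ψ γ t)) ξ a 1 = 0 := by
  set χ := extChartAt (J1Model n) y₀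
  set x : ℝ → J1Space n := fun t => χ (pullback ψ γ t) with hxdef
  have hsub : Icc a 1 ⊆ Icc (0 : ℝ) 1 := Icc_subset_Icc_left ha0
  have hx : ContDiffOn ℝ ∞ x (Icc a 1) := fun t ht => by
    rw [← contMDiffWithinAt_iff_contDiffWithinAt]
    exact (contMDiffAt_chart (hy t ht)).comp_contMDiffWithinAt t
      (((isHorizontal_pullback hH hψ γ).1 t (hsub ht)).mono hsub)
  by_contra hne
  -- The forbidden direction: a first-order motion of the end point of u that ψ^1 carries to the
  -- Reeb vector at γ(1).
  obtain ⟨w, hw⟩ := exists_tangentMap_eq hψ γ (reeb (evalOne γ))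
  set W : J1Space n := mvfderiv (J1Model n) χ (pullback ψ γ 1) w
  set b := (a + 1) / 2 with hb
  have hab : a < b := by linarith
  have hb1 : b < 1 := by linarith
  -- A cutoff that produces the (q, p)-part of w at time 1; its z-part is not controlled.
  set ζ : ℝ → Model n × (Model n →L[ℝ] ℝ) :=
    fun t => Real.smoothTransition ((t - b) / (1 - b)) • W.1 with hζdef
  have hζ : ContDiff ℝ ∞ ζ :=
    (Real.smoothTransition.contDiff.comp ((contDiff_id.sub contDiff_const).div_const _)).smul
      contDiff_const
  have hζ0 : ∀ t < b, ζ t = 0 := fun t ht => by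
    have : (t - b) / (1 - b) ≤ 0 := div_nonpos_of_nonpos_of_nonneg (by linarith) (by linarith)
    simp [hζdef, Real.smoothTransition.zero_of_nonpos this]
  have hζ1 : ζ 1 = W.1 := by
    have : (1 - b) / (1 - b) = 1 := div_self (by linarith)
    simp [hζdef, this]
  -- As ξ vanishes at time 1, adding m·ξ changes only the z-part of the end velocity; m is chosen to
  -- give it the value `W.2`.
  set m := (W.2 - firstVariation x ζ a 1) / firstVariation x ξ a 1 with hm
  obtain ⟨c, hc, hc0, hct⟩ := exists_smoothFamily hH hψ γ ha0 ha1 hy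
    (hζ.add (hξ.const_smul m)) (lt_min hab ht₂) (fun t ht => by
      simp [hζ0 t (ht.trans_le (min_le_left _ _)), hξ0 t (ht.trans_le (min_le_right _ _))]) w (by
      refine Prod.ext ?_ ?_
      · simp [hζ1, hξ1, W, χ]
      · refine Eq.trans ?_ (firstVariation_add_smul ha1 hx hζ hξ m).symm
        rw [hm, div_mul_cancel₀ _ hne, add_sub_cancel])
  rw [hw] at hct
  have h1 := representsOver_of_tangentMap_evalOne hc hc0 hct
  rw [mfderiv_toBase_reeb] at h1
  have h2 := hasDerivAt_actionCC (ψ := ψ) hc hc0 hct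
  rw [mvfderiv_zCoord_reeb] at h2
  -- The Reeb vector is vertical with dz = 1, so the action would have derivative 1 along a family
  -- where criticality demands 0.
  exact one_ne_zero (h2.unique (hγ c h1))

end CriticalPaths

/-! ### Vanishing first variation forces the pulled back path to be constant -/

section Constancy

section Variational

variable {n : ℕ} {x : ℝ → J1Space n} {a : ℝ}

/-- Integration by parts moves the derivative from g to p; the boundary term g·p(v) vanishes at both
ends. -/
lemma firstVariation_smul_const (ha : a < 1) (hx : ContDiffOn ℝ ∞ x (Icc a 1)) {g : ℝ → ℝ}
    (hg : ContDiff ℝ ∞ g) (hga : g a = 0) (hg1 : g 1 = 0) (v : Model n × (Model n →L[ℝ] ℝ)) :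
    firstVariation x (fun t => g t • v) a 1 =
      ∫ t in a..1, g t * (v.2 (derivWithin x (Icc a 1) t).1.1 -
        (derivWithin x (Icc a 1) t).1.2 v.1) := by
  have hx' : ∀ t ∈ Icc a 1, HasDerivWithinAt x (derivWithin x (Icc a 1) t) (Icc a 1) t :=
    fun t ht => (hx.differentiableOn (by simp) t ht).hasDerivWithinAt
  have hgd : ∀ t, HasDerivAt g (deriv g t) t := fun t => (hg.differentiable (by simp) t).hasDerivAt
  have hdx := ((contDiffOn_infty_iff_derivWithin (uniqueDiffOn_Icc ha)).1 hx).2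
  have hdg := (contDiff_infty_iff_deriv.1 hg).2
  have hprod : ∀ t ∈ Icc a 1, HasDerivWithinAt (fun t => g t * (x t).1.2 v.1)
      (deriv g t * (x t).1.2 v.1 + g t * (derivWithin x (Icc a 1) t).1.2 v.1) (Icc a 1) t :=
    fun t ht => by
      have h1 := ((ContinuousLinearMap.apply ℝ ℝ v.1).comp
        ((ContinuousLinearMap.snd ℝ (Model n) (Model n →L[ℝ] ℝ)).comp
        (ContinuousLinearMap.fst ℝ (Model n × (Model n →L[ℝ] ℝ)) ℝ))).hasFDerivAt
        (x := x t) |>.comp_hasDerivWithinAt t (hx' t ht)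
      exact (hgd t).hasDerivWithinAt.mul h1
  have hcont : ContinuousOn (fun t => deriv g t * (x t).1.2 v.1 +
      g t * (derivWithin x (Icc a 1) t).1.2 v.1) (Icc a 1) :=
    (hdg.continuous.continuousOn.mul (hx.continuousOn.fst.snd.clm_apply continuousOn_const)).add
      (hg.continuous.continuousOn.mul (hdx.continuousOn.fst.snd.clm_apply continuousOn_const))
  have hFTC : ∫ t in a..1, (deriv g t * (x t).1.2 v.1 +
      g t * (derivWithin x (Icc a 1) t).1.2 v.1) = 0 := by
    rw [intervalIntegral.integral_eq_sub_of_hasDeriv_right_of_le ha.le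
      (f := fun t => g t * (x t).1.2 v.1) (fun t ht => (hprod t ht).continuousWithinAt)
      (fun t ht => (hprod t (Ioo_subset_Icc_self ht)).hasDerivAt (Icc_mem_nhds ht.1 ht.2)
        |>.hasDerivWithinAt)
      (hcont.intervalIntegrable_of_Icc ha.le), hga, hg1]
    simp
  have hcont2 : ContinuousOn (fun t => g t * (v.2 (derivWithin x (Icc a 1) t).1.1 -
        (derivWithin x (Icc a 1) t).1.2 v.1)) (Icc a 1) :=
    hg.continuous.continuousOn.mul ((continuousOn_const.clm_apply hdx.continuousOn.fst.fst).sub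
      (hdx.continuousOn.fst.snd.clm_apply continuousOn_const))
  rw [← add_zero (∫ t in a..1, g t * (v.2 (derivWithin x (Icc a 1) t).1.1 -
        (derivWithin x (Icc a 1) t).1.2 v.1)), ← hFTC,
    ← intervalIntegral.integral_add (hcont2.intervalIntegrable_of_Icc ha.le)
      (hcont.intervalIntegrable_of_Icc ha.le), firstVariation]
  refine intervalIntegral.integral_congr fun t _ => ?_
  have hd : deriv (fun t => g t • v) t = deriv g t • v := ((hgd t).smul_const v).deriv
  simp only [hd, Prod.smul_snd, Prod.smul_fst, _root_.smul_apply, map_smul, smul_eq_mul]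
  ring

/-- A curve tangent to the contact distribution with vanishing first variation is constant. -/
lemma eqOn_const_of_firstVariation_eq_zero (ha : a < 1) (hx : ContDiffOn ℝ ∞ x (Icc a 1))
    (hhor : ∀ t ∈ Ioo a 1, stdForm (x t) (derivWithin x (Icc a 1) t) = 0)
    (hvar : ∀ ξ : ℝ → Model n × (Model n →L[ℝ] ℝ), ContDiff ℝ ∞ ξ → ∀ t₂ > a, (∀ t < t₂, ξ t = 0) →
      ξ 1 = 0 → firstVariation x ξ a 1 = 0) : ∀ t ∈ Icc a 1, x t = x a := by
  have hdx := ((contDiffOn_infty_iff_derivWithin (uniqueDiffOn_Icc ha)).1 hx).2.continuousOn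
  have hzero : ∀ v : Model n × (Model n →L[ℝ] ℝ), ∀ t ∈ Ioo a 1,
      v.2 (derivWithin x (Icc a 1) t).1.1 - (derivWithin x (Icc a 1) t).1.2 v.1 = 0 := by
    intro v
    set f : ℝ → ℝ := fun t => v.2 (derivWithin x (Icc a 1) t).1.1 -
      (derivWithin x (Icc a 1) t).1.2 v.1
    have hf : ContinuousOn f (Ioo a 1) := ((continuousOn_const.clm_apply hdx.fst.fst).sub
      (hdx.fst.snd.clm_apply continuousOn_const)).mono Ioo_subset_Icc_self
    -- The fundamental lemma of the calculus of variations, with test functions supported in the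
    -- open interval.
    have hae := isOpen_Ioo.ae_eq_zero_of_integral_contDiff_smul_eq_zero (μ := MeasureTheory.volume)
      (hf.locallyIntegrableOn measurableSet_Ioo) fun g hg hgc hgs => by
        have hout : ∀ t, t ∉ Ioo a 1 → g t = 0 := fun t ht =>
          image_eq_zero_of_notMem_tsupport fun h => ht (hgs h)
        -- The least point of the compact support serves as t₂; for empty support any number above a
        -- does.
        obtain ⟨t₂, ht₂, hgt₂⟩ : ∃ t₂ > a, ∀ t < t₂, g t = 0 := by
          rcases (tsupport g).eq_empty_or_nonempty with he | hne
          · refine ⟨a + 1, by simp, fun t _ => image_eq_zero_of_notMem_tsupport ?_⟩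
            simp [he]
          · obtain ⟨t₂, ht₂, hmin⟩ := hgc.isCompact.exists_isLeast hne
            exact ⟨t₂, (hgs ht₂).1, fun t ht => image_eq_zero_of_notMem_tsupport
              fun h => (hmin h).not_gt ht⟩
        have h := hvar (fun t => g t • v) (hg.smul contDiff_const) t₂ ht₂
          (fun t ht => by simp [hgt₂ t ht]) (by simp [hout 1])
        rw [firstVariation_smul_const ha hx hg (hout a (by simp)) (hout 1 (by simp)),
          intervalIntegral.integral_of_le ha.le, MeasureTheory.integral_Ioc_eq_integral_Ioo,
          MeasureTheory.setIntegral_eq_integral_of_forall_compl_eq_zero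
            (fun t ht => by rw [hout t ht, zero_mul])] at h
        exact h
    have h2 := MeasureTheory.Measure.eqOn_open_of_ae_eq (f := f) (g := fun _ => (0 : ℝ))
      (μ := MeasureTheory.volume) ((MeasureTheory.ae_restrict_iff' measurableSet_Ioo).2 hae)
      isOpen_Ioo hf continuousOn_const
    exact h2
  have hder : ∀ t ∈ Ioo a 1, derivWithin x (Icc a 1) t = 0 := fun t ht => by
    set D := derivWithin x (Icc a 1) t with hD
    have hq : D.1.1 = 0 := by
      -- Testing with the covector dual to q' gives |q'|² = 0.
      have h := hzero (0, innerSL ℝ D.1.1) t ht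
      simpa [← hD] using h
    have hp : D.1.2 = 0 := by
      ext v : 1
      have h := hzero (v, 0) t ht
      simpa [← hD] using h
    have hz := hhor t ht
    rw [← hD, stdForm_apply, hq, map_zero, sub_zero] at hz
    exact Prod.ext (Prod.ext hq hp) hz
  have hder' : EqOn (derivWithin x (Icc a 1)) (fun _ => 0) (Icc a 1) :=
    EqOn.of_subset_closure (s := Ioo a 1) hder hdx continuousOn_const Ioo_subset_Icc_self
      (by rw [closure_Ioo ha.ne])
  exact constant_of_derivWithin_zero (hx.differentiableOn (by simp))
    fun t ht => hder' (Ico_subset_Icc_self ht)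

end Variational

variable {n : ℕ} {B : Type*} [TopologicalSpace B] [ChartedSpace (Model n) B]
  [IsManifold (𝓡 n) ∞ B] {H : ℝ → J1 n B → ℝ} {ψ : ℝ → J1 n B ≃ J1 n B}

/-- Perturbations are available only on a final interval [a,1] inside one chart, so constancy is
pushed backwards from time 1. Let τ be the infimum of times from which u is constant. The constant
part sits at a point near u(τ), hence in the chart around u(τ), so a whole interval starting before
τ (or at 0) lies in that chart. -/
lemma eqOn_const_of_locally {u : ℝ → J1 n B} (hu : ContinuousOn u (Icc 0 1))
    (h : ∀ a, 0 ≤ a → a < 1 → ∀ y₀, (∀ t ∈ Icc a 1, u t ∈ (extChartAt (J1Model n) y₀).source) →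
      ∀ t ∈ Icc a 1, u t = u 1) : ∀ t ∈ Icc (0 : ℝ) 1, u t = u 1 := by
  set S : Set ℝ := {a | a ∈ Icc (0 : ℝ) 1 ∧ ∀ t ∈ Icc a 1, u t = u 1} with hS
  have h1S : (1 : ℝ) ∈ S := ⟨by simp, fun t ht => by rw [le_antisymm ht.2 ht.1]⟩
  have hbdd : BddBelow S := ⟨0, fun a ha => ha.1.1⟩
  set τ := sInf S
  have hτ0 : 0 ≤ τ := le_csInf ⟨1, h1S⟩ fun a ha => ha.1.1
  have hτ1 : τ ≤ 1 := csInf_le hbdd h1S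
  set y₀ := u τ
  have hnhds := (hu τ ⟨hτ0, hτ1⟩).preimage_mem_nhdsWithin
    ((isOpen_extChartAt_source (I := J1Model n) y₀).mem_nhds (mem_extChartAt_source y₀))
  obtain ⟨ε, hε, hsub⟩ := Metric.mem_nhdsWithin_iff.1 hnhds
  obtain ⟨s, hs, hsτ⟩ := exists_lt_of_csInf_lt ⟨1, h1S⟩ (lt_add_of_pos_right τ hε)
  have hsrc : ∀ t ∈ Icc (0 : ℝ) 1, τ - ε < t → t ≤ s → u t ∈ (extChartAt (J1Model n) y₀).source :=
    fun t ht h1 h2 => hsub ⟨by rw [Real.ball_eq_Ioo]; exact ⟨h1, h2.trans_lt hsτ⟩, ht⟩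
  have hτs : τ ≤ s := csInf_le hbdd hs
  set a := max 0 (τ - ε / 2) with ha
  have ha1 : a < 1 := max_lt zero_lt_one (by linarith)
  have hmem : a ∈ S := by
    refine ⟨⟨le_max_left _ _, ha1.le⟩, h a (le_max_left _ _) ha1 y₀ fun t ht => ?_⟩
    have ht0 : 0 ≤ t := (le_max_left _ _).trans ht.1
    have ht1 : τ - ε / 2 ≤ t := (le_max_right _ _).trans ht.1
    rcases le_total t s with hts | hts
    · exact hsrc t ⟨ht0, ht.2⟩ (by linarith) hts
    · rw [hs.2 t ⟨hts, ht.2⟩, ← hs.2 s ⟨le_rfl, hs.1.2⟩]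
      exact hsrc s hs.1 (by linarith) le_rfl
  have hτa : τ ≤ a := csInf_le hbdd hmem
  -- Otherwise a = τ - ε/2 would be a member of S below its infimum.
  have ha0 : a = 0 := by
    rcases max_choice 0 (τ - ε / 2) with h | h
    · exact h
    · rw [ha, h] at hτa
      linarith
  rw [← ha0]
  exact hmem.2

/-- Vertical critical points are Hamiltonian trajectories. -/
lemma ext_eq_flow_of_mem_verticalCriticalSet (hH : IsSmoothHamiltonian H)
    (hψ : IsContactHamiltonianFlow H ψ) {γ : CarnotPath H} (hγ : γ ∈ verticalCriticalSet H ψ) :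
    ∀ t ∈ Icc (0 : ℝ) 1, ext γ.1 t = ψ t (γ.1 0) := by
  have hu := isHorizontal_pullback hH hψ γ
  have hconst : ∀ t ∈ Icc (0 : ℝ) 1, pullback ψ γ t = pullback ψ γ 1 := by
    refine eqOn_const_of_locally hu.1.continuousOn fun a ha0 ha1 y₀ hy => ?_
    have hsub : Icc a 1 ⊆ Icc (0 : ℝ) 1 := Icc_subset_Icc_left ha0
    have h := eqOn_const_of_firstVariation_eq_zero
      (x := fun t => extChartAt (J1Model n) y₀ (pullback ψ γ t)) ha1 (fun t ht => by
        rw [← contMDiffWithinAt_iff_contDiffWithinAt]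
        exact (contMDiffAt_chart (hy t ht)).comp_contMDiffWithinAt t
          ((hu.1 t (hsub ht)).mono hsub))
      (fun t ht => by
        have ht' := hsub (Ioo_subset_Icc_self ht)
        refine Eq.trans ?_ (hu.2 t ht')
        rw [← derivWithin_Icc_eq_of_lt _ ha0 ht.1, contactForm_velocity (hu.1.mdifferentiableOn (by simp) t ht')
          (uniqueDiffOn_Icc zero_lt_one t ht') (hy t (Ioo_subset_Icc_self ht))])
      fun ξ hξ t₂ ht₂ hξ0 hξ1 => firstVariation_eq_zero_of_mem_verticalCriticalSet hH hψ hγ ha0 ha1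
        hy hξ ht₂ hξ0 hξ1
    exact fun t ht => (extChartAt (J1Model n) y₀).injOn (hy t ht) (hy 1 ⟨ha1.le, le_rfl⟩)
      ((h t ht).trans (h 1 ⟨ha1.le, le_rfl⟩).symm)
  intro t ht
  rw [← apply_pullback (ψ := ψ) γ t, hconst t ht, ← hconst 0 (by simp), pullback_zero hψ]

end Constancy

/-! ### The horizontal derivative along trajectories -/

section HorizontalDerivative

variable {n : ℕ} {B : Type*} [TopologicalSpace B] [ChartedSpace (Model n) B]
  [IsManifold (𝓡 n) ∞ B] {H : ℝ → J1 n B → ℝ} {ψ : ℝ → J1 n B ≃ J1 n B}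

lemma IsContactHamiltonianVector.congr_of_eventuallyEq {h : J1 n B → ℝ} {f g : ℝ → J1 n B} {t : ℝ}
    (ht : t ∈ Icc (0 : ℝ) 1) (hfg : f =ᶠ[nhdsWithin t (Icc 0 1)] g)
    (hg : IsContactHamiltonianVector h (g t)
      (mfderivWithin 𝓘(ℝ, ℝ) (J1Model n) g (Icc 0 1) t (unitTangent t))) :
    IsContactHamiltonianVector h (f t)
      (mfderivWithin 𝓘(ℝ, ℝ) (J1Model n) f (Icc 0 1) t (unitTangent t)) := by
  have h0 : f t = g t := hfg.eq_of_nhdsWithin ht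
  have hc : ∀ y : J1 n B, f t = y → IsContactHamiltonianVector h y
      (mfderivWithin 𝓘(ℝ, ℝ) (J1Model n) f (Icc 0 1) t (unitTangent t)) →
      IsContactHamiltonianVector h (f t)
      (mfderivWithin 𝓘(ℝ, ℝ) (J1Model n) f (Icc 0 1) t (unitTangent t)) := by
    rintro _ rfl h
    exact h
  refine hc _ h0 ?_
  rw [hfg.mfderivWithin_eq h0]
  exact hg

lemma contactForm_apply (y : J1 n B) (v : TangentSpace (J1Model n) y) :
    contactForm y v = mvfderiv (J1Model n) zCoord y v -
      momentum y (mfderiv (J1Model n) (𝓡 n) toBase y v) := rfl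

/-- The zero section is Legendrian: p = 0 there and z is constant. This gives the initial value of
the linear equation. -/
lemma contactForm_velocity_zeroSection {f : ℝ → J1 n B} (hf : MDifferentiableAt 𝓘(ℝ, ℝ) (J1Model n) f 0)
    (h : ∀ s, f s ∈ zeroSection n B) :
    contactForm (f 0) (mfderiv 𝓘(ℝ, ℝ) (J1Model n) f 0 (unitTangent 0)) = 0 := by
  have hp : momentum (f 0) = 0 := (h 0).1
  rw [contactForm_apply, hp]
  have h1 := mfderiv_comp_apply 0 (I' := J1Model n) (mdifferentiable_zCoord (f 0)) hf (unitTangent 0)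
  have h2 : zCoord ∘ f = fun _ => (0 : ℝ) := funext fun s => (h s).2
  rw [h2, mfderiv_const] at h1
  have h3 : mvfderiv (J1Model n) zCoord (f 0) (mfderiv 𝓘(ℝ, ℝ) (J1Model n) f 0 (unitTangent 0)) = 0 :=
    h1.symm
  rw [h3]
  simp

/-- The end velocity η of a variation satisfies λ(η) = 0, by the linear equation with zero initial
value. This reads dz(η) = p(dπ_B(η)), and dz(η) is the derivative of the action. -/
lemma isHorizontalDerivative_momentum (hH : IsSmoothHamiltonian H)
    (hψ : IsContactHamiltonianFlow H ψ) {γ : CarnotPath H}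
    (hγ : ∀ t ∈ Icc (0 : ℝ) 1, ext γ.1 t = ψ t (γ.1 0)) :
    IsHorizontalDerivative ψ γ (momentum (evalOne γ)) := by
  rintro c v ⟨hc, rfl, hv⟩
  have hm := hc.mdifferentiableAt_evalOne
  set η := mfderiv 𝓘(ℝ, ℝ) (J1Model n) (fun s => evalOne (c s)) 0 (unitTangent 0) with hη
  have hπ : mfderiv (J1Model n) (𝓡 n) toBase (evalOne (c 0)) η = v := by
    have h1 := mfderiv_comp_apply 0 (I' := J1Model n) (mdifferentiable_toBase (evalOne (c 0))) hm
      (unitTangent 0)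
    refine h1.symm.trans ?_
    simpa [tangentMap] using! hv
  have hd := hasDerivAt_actionCC (ψ := ψ) (γ := c 0) hc rfl (η := η) rfl
  refine hd.congr_deriv ?_
  have h0 : contactForm (evalOne (c 0)) η = 0 := by
    obtain ⟨δ, hδ, hs⟩ := hc
    have h01 : (0 : ℝ) ∈ Icc (0 : ℝ) 1 := by simp
    have h11 : (1 : ℝ) ∈ Icc (0 : ℝ) 1 := by simp
    have h0δ : (0 : ℝ) ∈ Ioo (-δ) δ := ⟨by linarith, hδ⟩
    have hz : ∀ s, ext (c s).1 0 ∈ zeroSection n B := fun s => by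
      rw [ext_zero]
      exact (c s).2.2.2
    have h := contactForm_variation_eq_zero hH hδ (c := fun s t => ext (c s).1 t) hs
      (fun s _ t ht => eq_neg_of_add_eq_zero_left ((c s).2.2.1 t ht))
      (fun t ht => IsContactHamiltonianVector.congr_of_eventuallyEq ht
        (Filter.eventuallyEq_of_mem self_mem_nhdsWithin hγ) (hψ.deriv t ht ((c 0).1 0)))
      h01 (contactForm_velocity_zeroSection (((contMDiffOn_slice_fst
        (c := fun s t => ext (c s).1 t) hs h01).mdifferentiableOn (by simp) 0 h0δ).mdifferentiableAt
        (isOpen_Ioo.mem_nhds h0δ)) hz) h11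
    have e : (fun s => evalOne (c s)) = fun s => ext (c s).1 1 := funext fun s => (ext_one _).symm
    exact (contactForm_velocity_congr (s := 0) (f := fun s => ext (c s).1 1)
      (g := fun s => evalOne (c s)) e).trans h
  rw [contactForm_apply, hπ] at h0
  exact sub_eq_zero.1 h0

lemma extChartAt_fst_snd_eq_zero {y₀ y : J1 n B} (hy : y ∈ (extChartAt (J1Model n) y₀).source)
    (hp : momentum y = 0) : (extChartAt (J1Model n) y₀ y).1.2 = 0 := by
  have hb : toBase y ∈ (extChartAt (𝓡 n) (toBase y₀)).source := by
    rw [extChartAt_source]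
    exact (extChartAt_source_iff _ _).1 hy
  have h := mfderiv_extChartAt_comp_mfderivWithin_extChartAt_symm' (I := 𝓡 n) hb
  refine ContinuousLinearMap.ext fun e => ?_
  have he := DFunLike.congr_fun h e
  refine (congrArg (extChartAt (J1Model n) y₀ y).1.2 he.symm).trans
    ((extChartAt_fst_snd y₀ y hy _).trans ?_)
  rw [hp]
  rfl

/-- The contact hyperplanes project onto the tangent spaces of the base. -/
lemma exists_contactForm_eq_zero_of_toBase (y : J1 n B) (v : TangentSpace (𝓡 n) (toBase y)) :
    ∃ η : TangentSpace (J1Model n) y, contactForm y η = 0 ∧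
      mfderiv (J1Model n) (𝓡 n) toBase y η = v := by
  have hy := mem_extChartAt_source (I := J1Model n) y
  obtain ⟨η, hη⟩ := mvfderiv_chart_surjective hy
    ((mvfderiv (𝓡 n) (extChartAt (𝓡 n) (toBase y)) (toBase y) v, 0), momentum y v)
  have hb := mem_extChartAt_source (I := 𝓡 n) (toBase y)
  have hinj : Function.Injective (mvfderiv (𝓡 n) (extChartAt (𝓡 n) (toBase y)) (toBase y)) := by
    have h := mfderivWithin_extChartAt_symm_comp_mfderiv_extChartAt' (I := 𝓡 n) hb
    exact Function.LeftInverse.injective fun v => DFunLike.congr_fun h v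
  refine ⟨η, ?_, hinj ?_⟩
  · rw [contactForm_eq_stdForm hy, hη, stdForm_apply, extChartAt_fst_snd _ _ hy, sub_self]
  · rw [mvfderiv_chart_mfderiv_toBase hy, hη]

/-- Gives uniqueness of the horizontal derivative. Lift v to η in the contact hyperplane at γ(1) and
transport it by the inverse flow to w in the contact hyperplane at γ(0). There u is constant with p
= 0, so every first variation vanishes, which matches the vanishing z-part of w. -/
lemma exists_representsOver (hH : IsSmoothHamiltonian H) (hψ : IsContactHamiltonianFlow H ψ)
    {γ : CarnotPath H} (hγ : ∀ t ∈ Icc (0 : ℝ) 1, ext γ.1 t = ψ t (γ.1 0))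
    (v : TangentSpace (𝓡 n) (fibration γ)) : ∃ c : ℝ → CarnotPath H, RepresentsOver c γ v := by
  have h11 : (1 : ℝ) ∈ Icc (0 : ℝ) 1 := by simp
  obtain ⟨η, hη, hηv⟩ := exists_contactForm_eq_zero_of_toBase (evalOne γ) v
  obtain ⟨w, hw⟩ := exists_tangentMap_eq hψ γ η
  have hu : ∀ t ∈ Icc (0 : ℝ) 1, pullback ψ γ t = γ.1 0 := fun t ht => by
    rw [pullback, hγ t ht, Equiv.symm_apply_apply]
  have hker : contactForm (pullback ψ γ 1) w = 0 := by
    rw [← hψ.contactForm_mfderiv_eq_zero_iff hH h11]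
    have : ∀ q : TangentBundle (J1Model n) (J1 n B), tangentMap (J1Model n) (J1Model n) (ψ 1)
      ⟨pullback ψ γ 1, w⟩ = q → contactForm q.1 q.2 = 0 → contactForm (ψ 1 (pullback ψ γ 1))
        (mfderiv (J1Model n) (J1Model n) (ψ 1) (pullback ψ γ 1) w) = 0 := by
      rintro _ rfl h
      exact h
    exact this _ hw hη
  set y₀ := γ.1 0
  set χ := extChartAt (J1Model n) y₀
  have hy : ∀ t ∈ Icc (0 : ℝ) 1, pullback ψ γ t ∈ χ.source := fun t ht => by
    rw [hu t ht]
    exact mem_extChartAt_source y₀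
  have hp : ∀ t ∈ Icc (0 : ℝ) 1, (χ (pullback ψ γ t)).1.2 = 0 := fun t ht => by
    refine extChartAt_fst_snd_eq_zero (hy t ht) ?_
    rw [hu t ht]
    exact γ.2.2.2.1
  set W : J1Space n := mvfderiv (J1Model n) χ (pullback ψ γ 1) w
  have hW2 : W.2 = 0 := by
    have h := contactForm_eq_stdForm (hy 1 h11) w
    rw [hker, stdForm_apply, hp 1 h11, _root_.zero_apply, sub_zero] at h
    exact h.symm
  set ζ : ℝ → Model n × (Model n →L[ℝ] ℝ) :=
    fun t => Real.smoothTransition (2 * t - 1) • W.1 with hζdef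
  have hζ : ContDiff ℝ ∞ ζ := (Real.smoothTransition.contDiff.comp
    ((contDiff_const.mul contDiff_id).sub contDiff_const)).smul contDiff_const
  obtain ⟨c, hc, hc0, hct⟩ := exists_smoothFamily hH hψ γ le_rfl zero_lt_one hy hζ
    (t₂ := 1 / 2) (by norm_num) (fun t ht => by
      have : 2 * t - 1 ≤ 0 := by linarith
      simp [hζdef, Real.smoothTransition.zero_of_nonpos this]) w (by
      refine Prod.ext ?_ ?_
      · have h1 : ζ 1 = W.1 := by
          have : (2 * 1 - 1 : ℝ) = 1 := by norm_num
          simp only [hζdef, this, Real.smoothTransition.one, one_smul]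
        exact h1.symm
      · refine hW2.trans ?_
        rw [firstVariation, intervalIntegral.integral_congr (g := fun _ => 0)]
        · simp
        · intro t ht
          rw [uIcc_of_le zero_le_one] at ht
          have hd : derivWithin (fun t => χ (pullback ψ γ t)) (Icc 0 1) t = 0 := by
            rw [derivWithin_congr (f := fun _ => χ y₀) (fun t ht => by rw [hu t ht])
              (by rw [hu t ht])]
            simp
          have e : (ζ t).2 (derivWithin (fun t => χ (pullback ψ γ t)) (Icc 0 1) t).1.1 +
              (χ (pullback ψ γ t)).1.2 (deriv ζ t).1 = 0 := by
            rw [hd, hp t ht]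
            simp
          exact e)
  rw [hw] at hct
  refine ⟨c, ?_⟩
  rw [← hηv]
  exact representsOver_of_tangentMap_evalOne hc hc0 hct

lemma existsUnique_isHorizontalDerivative (hH : IsSmoothHamiltonian H)
    (hψ : IsContactHamiltonianFlow H ψ) {γ : CarnotPath H}
    (hγ : ∀ t ∈ Icc (0 : ℝ) 1, ext γ.1 t = ψ t (γ.1 0)) :
    ∃! α, IsHorizontalDerivative ψ γ α := by
  refine ⟨_, isHorizontalDerivative_momentum hH hψ hγ, fun α hα => ?_⟩
  refine ContinuousLinearMap.ext fun v => ?_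
  obtain ⟨c, hc⟩ := exists_representsOver hH hψ hγ v
  exact (hα c v hc).unique (isHorizontalDerivative_momentum hH hψ hγ c v hc)

lemma jetMap_eq_evalOne (hH : IsSmoothHamiltonian H) (hψ : IsContactHamiltonianFlow H ψ)
    (γ : verticalCriticalSet H ψ) : jetMap ψ γ = evalOne γ.1 := by
  have hγ := ext_eq_flow_of_mem_verticalCriticalSet hH hψ γ.2
  have hD : horizontalDerivative ψ γ.1 = momentum (evalOne γ.1) :=
    (existsUnique_isHorizontalDerivative hH hψ hγ).unique
      (Classical.epsilon_spec (existsUnique_isHorizontalDerivative hH hψ hγ).exists)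
      (isHorizontalDerivative_momentum hH hψ hγ)
  rw [jetMap, hD, actionCC_eq]
  rfl

lemma evalOne_eq_flow (hH : IsSmoothHamiltonian H) (hψ : IsContactHamiltonianFlow H ψ)
    (γ : verticalCriticalSet H ψ) : evalOne γ.1 = ψ 1 (γ.1.1 0) := by
  rw [← ext_eq_flow_of_mem_verticalCriticalSet hH hψ γ.2 1 (by simp), ext_one]
  rfl

/-- The constant path at y is horizontal, and the flow carries it to the trajectory from y.
Criticality is the formula for the horizontal derivative at dΠ(η) = 0. -/
lemma exists_mem_verticalCriticalSet (hH : IsSmoothHamiltonian H)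
    (hψ : IsContactHamiltonianFlow H ψ) {y : J1 n B} (hy : y ∈ zeroSection n B) :
    ∃ γ : verticalCriticalSet H ψ, evalOne γ.1 = ψ 1 y := by
  have hv : IsHorizontal (fun _ : ℝ => y) := by
    refine ⟨contMDiffOn_const, fun t _ => ?_⟩
    rw [mfderivWithin_const]
    exact map_zero (contactForm y).toLinearMap
  obtain ⟨γ, hγ⟩ := exists_carnotPath hH hψ hv hy
  have h0 : γ.1 0 = y := by rw [← ext_zero, hγ 0 (by simp), hψ.zero]
  refine ⟨⟨γ, fun c hc => ?_⟩, ?_⟩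
  · have h := isHorizontalDerivative_momentum hH hψ (γ := γ) (by rwa [h0]) c 0 hc
    exact h.congr_deriv (map_zero (momentum (evalOne γ)))
  · rw [← hγ 1 (by simp), ext_one]
    rfl

end HorizontalDerivative

end OneJet

end

theorem proposition4p5 (n : ℕ) (B : Type*) [TopologicalSpace B] [T2Space B]
    [SecondCountableTopology B] [ChartedSpace (OneJet.Model n) B] [IsManifold (𝓡 n) ∞ B]
    (H : ℝ → OneJet.J1 n B → ℝ) (hH : OneJet.IsSmoothHamiltonian H)
    (ψ : ℝ → OneJet.J1 n B ≃ OneJet.J1 n B) (hψ : OneJet.IsContactHamiltonianFlow H ψ) :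
    -- the horizontal derivative exists and is unique on the vertical critical set
    (∀ γ ∈ OneJet.verticalCriticalSet H ψ, ∃! α, OneJet.IsHorizontalDerivative ψ γ α) ∧
    -- the map is the evaluation at time one
    (∀ γ : OneJet.verticalCriticalSet H ψ, OneJet.jetMap ψ γ = OneJet.evalOne γ.1) ∧
    Continuous (OneJet.jetMap (H := H) ψ) ∧
    Function.Injective (OneJet.jetMap (H := H) ψ) ∧
    Set.range (OneJet.jetMap (H := H) ψ) = ψ 1 '' OneJet.zeroSection n B := by
  have hjet : OneJet.jetMap (H := H) ψ = fun γ => OneJet.evalOne γ.1 :=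
    funext (OneJet.jetMap_eq_evalOne hH hψ)
  refine ⟨fun γ hγ => OneJet.existsUnique_isHorizontalDerivative hH hψ
    (OneJet.ext_eq_flow_of_mem_verticalCriticalSet hH hψ hγ),
    OneJet.jetMap_eq_evalOne hH hψ, ?_, ?_, ?_⟩
  · rw [hjet]
    exact (continuous_eval_const 1).comp
      (continuous_subtype_val.comp continuous_subtype_val)
  · intro γ γ' h
    rw [hjet] at h
    -- Equal end points give equal starting points, and a critical path is the trajectory of its
    -- starting point.
    simp only [OneJet.evalOne_eq_flow hH hψ, (ψ 1).injective.eq_iff] at h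
    refine Subtype.ext (Subtype.ext (ContinuousMap.ext fun t => ?_))
    have h1 := OneJet.ext_eq_flow_of_mem_verticalCriticalSet hH hψ γ.2 t t.2
    have h2 := OneJet.ext_eq_flow_of_mem_verticalCriticalSet hH hψ γ'.2 t t.2
    rw [OneJet.ext_apply_of_mem _ t.2] at h1 h2
    exact h1.trans ((congrArg (ψ t) h).trans h2.symm)
  · rw [hjet]
    ext y
    constructor
    · rintro ⟨γ, rfl⟩
      exact ⟨γ.1.1 0, γ.1.2.2.2, (OneJet.evalOne_eq_flow hH hψ γ).symm⟩
    · rintro ⟨y, hy, rfl⟩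
      exact OneJet.exists_mem_verticalCriticalSet hH hψ hy
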